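/- **Setting.** Let $B,N$ be natural numbers. In the 2-user deterministic time-varying broadcast channel with $B$ levels, in each channel use $t$ the transmitter sends $X_t\in\mathbb F_2^B$ and user $k\in\{1,2\}$ receives $Y_{k,t}=D^{B-L_k[t]}X_t$, i.e. the first $L_k[t]$ bits of $X_t$, where $D$ is the $B\times B$ down-shift matrix. The pairs $(L_1[t],L_2[t])\in\{0,\dots,B\}^2$ are i.i.d. over $t$ with an arbitrary joint law; user $k$ knows $(L_k[t])_t$, while the transmitter knows only the law. Put $\overline F_{L_k}(\ell)=\mathbb P[L_k\ge \ell]$ for $\ell=1,\dots,B$. A caching strategy $\mathfrak C$ with normalized cache size $\mu\in[0,1]$ gives each user $k$ a finite nonempty sequence of consecutive intervals $(a_{k,j},b_{k,j}]\subseteq(0,1]$ (possibly empty, with $b_{k,j}\le a_{k,j+1}$) of total length $\mu$; of every file of $F$ bits, user $k$ caches the bits with numbers $\lceil a_{k,j}F\rceil+1,\dots,\lfloor b_{k,j}F\rfloor$ for all $j$. The central strategy $\mathfrak C^{\mathsf{cent}}$ is: for $\mu\le\frac12$, user 1 has $(1-2\mu,1-\mu]$ and user 2 has $(1-\mu,1]$;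 for $\mu>\frac12$, user 1 has $(0,1-\mu]$ and $(2-2\mu,1]$, and user 2 has $(1-\mu,2-2\mu]$ and $(2-2\mu,1]$. There are $N$ independent uniformly distributed files, independent of the channel states, and the users request files $d_1\neq d_2$. A source rate $f\ge 0$ is achievable for $\mathfrak C$ and $d=(d_1,d_2)$ if, for files of $\lfloor nf\rfloor$ bits, there are for all $n$ an encoder mapping the $N$ files to $(X_1,\dots,X_n)$ and, for each user, a decoder estimating the requested file from the user's channel outputs, channel states and cache content, such that the sum of the two error probabilities tends to $0$ as $n\to\infty$. For $\omega>0$ let $$R_1(\omega)=\sum_{\ell:\ \omega\overline F_{L_1}(\ell)\ge\overline F_{L_2}(\ell)}\overline F_{L_1}(\ell),\qquad R_2(\omega)=\sum_{\ell:\ \omega\overline F_{L_1}(\ell)<\overline F_{L_2}(\ell)}\overline F_{L_2}(\ell).$$ **Theorem 1.** For $0\le\mu\le\frac12$ put $$f^\star=\min\left\{\inf_{\omega\ge1}\frac{\omega R_1(\omega)+R_2(\omega)}{\omega(1-\mu)+(1-2\mu)},\ \inf_{0<\omega\le1}\frac{R_1(\omega)+\frac1\omega R_2(\omega)}{(1-2\mu)+\frac1\omega(1-\mu)}\right\},$$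 and for $\frac12\le\mu<1$ put $$f^\star=\min\left\{\frac{\sum_{\ell=1}^B\overline F_{L_1}(\ell)}{1-\mu},\ \frac{\sum_{\ell=1}^B\overline F_{L_2}(\ell)}{1-\mu}\right\}.$$ In both cases, for every caching strategy with normalized cache size $\mu$ and every pair of distinct requests, every achievable source rate is at most $f^\star$. Moreover, with the central caching strategy, every source rate $f$ with $0\le f<f^\star$ is achievable (so $f^\star$ is the supremum of the achievable rates). For $\mu=1$, every source rate $f\ge0$ is achievable with the central caching strategy. -/

import Mathlib

open scoped BigOperators
open Filter Topology

namespace DTVBC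

/-! ### The channel -/

/-- The `B × B` down-shift matrix over `𝔽₂`: ones on the first subdiagonal. -/
def shiftMatrix (B : ℕ) : Matrix (Fin B) (Fin B) (ZMod 2) :=
  Matrix.of fun i j => if (i : ℕ) = (j : ℕ) + 1 then 1 else 0

/-- Channel output `D ^ (B - ℓ) X` when the input is `X ∈ 𝔽₂ᴮ` and the channel state is
`ℓ ∈ {0, …, B}`: exactly the `ℓ` most significant bits `X(1), …, X(ℓ)` survive. -/
def channelOutput {B : ℕ} (ℓ : Fin (B + 1)) (X : Fin B → ZMod 2) : Fin B → ZMod 2 :=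
  (shiftMatrix B ^ (B - (ℓ : ℕ))).mulVec X

/-- Complementary cumulative distribution function `ℙ[L_k ≥ ℓ]` of the state of user `k`, where
`P` is the joint probability mass function of the states `(L_1, …, L_K)` in one channel use. -/
noncomputable def ccdf {K B : ℕ} (P : PMF (Fin K → Fin (B + 1))) (k : Fin K) (ℓ : ℕ) : ℝ :=
  ∑ s : Fin K → Fin (B + 1), if ℓ ≤ (s k : ℕ) then (P s).toReal else 0

/-! ### Caching strategies -/

/-- A caching strategy for `K` users with normalized cache size `μ`: every user `k` gets a finite
nonempty collection of consecutive intervals `(a, b] ⊆ (0, 1]`, each stored as the pair `(a, b)`,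
of total length `μ`. -/
structure CachingStrategy (K : ℕ) (μ : ℝ) where
  intervals : Fin K → List (ℝ × ℝ)
  nonempty : ∀ k, intervals k ≠ []
  bounds : ∀ k, ∀ I ∈ intervals k, 0 ≤ I.1 ∧ I.1 ≤ I.2 ∧ I.2 ≤ 1
  ordered : ∀ k, (intervals k).Pairwise fun I J => I.2 ≤ J.1
  total_length : ∀ k, ((intervals k).map fun I => I.2 - I.1).sum = μ

/-- The positions of the bits of a file of `F` bits that user `k` caches: in the numbering
`1, …, F`, the bits `⌈a F⌉ + 1, …, ⌊b F⌋` for every interval `(a, b]` of user `k`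
(`j : Fin F` stands for bit number `j + 1`). -/
def CachingStrategy.cachedBits {K : ℕ} {μ : ℝ} (c : CachingStrategy K μ) (k : Fin K) (F : ℕ) :
    Set (Fin F) :=
  {j | ∃ I ∈ c.intervals k, ⌈I.1 * F⌉₊ ≤ (j : ℕ) ∧ (j : ℕ) < ⌊I.2 * F⌋₊}

/-- The central caching strategy for two users.
If `μ ≤ 1/2`, the part `(0, 1 - 2μ]` of each file is cached nowhere, and the rest is halved between
the two users. If `μ > 1/2`, the part `(2 - 2μ, 1]` is cached at both users, and the rest is halved
between them. -/
noncomputable def centralStrategy (μ : ℝ) (h0 : 0 ≤ μ) (h1 : μ ≤ 1) : CachingStrategy 2 μ where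
  intervals :=
    if μ ≤ 1 / 2 then ![[(1 - 2 * μ, 1 - μ)], [(1 - μ, 1)]]
    else ![[(0, 1 - μ), (2 - 2 * μ, 1)], [(1 - μ, 2 - 2 * μ), (2 - 2 * μ, 1)]]
  nonempty := by
    intro k
    split_ifs <;> fin_cases k <;> simp
  bounds := by
    intro k I hI
    split_ifs at hI with h <;> fin_cases k <;> simp at hI
    · subst hI; exact ⟨by linarith, by linarith, by linarith⟩
    · subst hI; exact ⟨by linarith, by linarith, by linarith⟩
    · rcases hI with rfl | rfl
      · exact ⟨by norm_num, by linarith, by linarith⟩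
      · exact ⟨by linarith, by linarith, by norm_num⟩
    · rcases hI with rfl | rfl
      · exact ⟨by linarith, by linarith, by linarith⟩
      · exact ⟨by linarith, by linarith, by norm_num⟩
  ordered := by
    intro k
    split_ifs with h <;> fin_cases k <;> simp
    linarith
  total_length := by
    intro k
    split_ifs with h <;> fin_cases k <;> simp <;> ring

/-! ### Codes and achievable rates -/

/-- A delivery code for `n` channel uses and `N` files of `F` bits each, with the caches filled
according to `c`. The encoder knows all files (hence all cache contents) but no channel state;
the decoder of user `k` knows its state sequence, its channel outputs and its cache content. -/
structure Code {K : ℕ} {μ : ℝ} (c : CachingStrategy K μ) (B N F n : ℕ) where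
  encode : (Fin N → Fin F → ZMod 2) → Fin n → Fin B → ZMod 2
  decode : (k : Fin K) → (Fin n → Fin (B + 1)) → (Fin n → Fin B → ZMod 2) →
    (Fin N → c.cachedBits k F → ZMod 2) → Fin F → ZMod 2

/-- The reconstruction by user `k`, for files `W` and channel states `s t k` (time `t`, user `k`). -/
def Code.estimate {K : ℕ} {μ : ℝ} {c : CachingStrategy K μ} {B N F n : ℕ} (C : Code c B N F n)
    (k : Fin K) (W : Fin N → Fin F → ZMod 2) (s : Fin n → Fin K → Fin (B + 1)) :
    Fin F → ZMod 2 :=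
  C.decode k (fun t => s t k) (fun t => channelOutput (s t k) (C.encode W t))
    (fun i j => W i j)

/-- The probability that user `k`, who requests file `d k`, decodes it wrongly. The files are
independent and uniformly distributed, and independent of the state vectors, which are i.i.d. over
time with law `P`. -/
noncomputable def Code.errorProb {K : ℕ} {μ : ℝ} {c : CachingStrategy K μ} {B N F n : ℕ}
    (C : Code c B N F n) (P : PMF (Fin K → Fin (B + 1))) (d : Fin K → Fin N) (k : Fin K) : ℝ :=
  ∑ W : Fin N → Fin F → ZMod 2, ∑ s : Fin n → Fin K → Fin (B + 1),
    if C.estimate k W s ≠ W (d k) then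
      (Fintype.card (Fin N → Fin F → ZMod 2) : ℝ)⁻¹ * ∏ t, (P (s t)).toReal
    else 0

/-- The source rate `f ≥ 0` is achievable for the caching strategy `c` and the request profile `d`:
for files of `⌊n f⌋` bits there is a sequence of codes over `n = 0, 1, 2, …` channel uses whose
sum of the users' error probabilities tends to `0`. -/
def Achievable {K B N : ℕ} {μ : ℝ} (P : PMF (Fin K → Fin (B + 1))) (c : CachingStrategy K μ)
    (d : Fin K → Fin N) (f : ℝ) : Prop :=
  0 ≤ f ∧ ∃ C : (n : ℕ) → Code c B N ⌊(n : ℝ) * f⌋₊ n,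
    Tendsto (fun n => ∑ k, (C n).errorProb P d k) atTop (𝓝 0)

/-! ### The rate bounds for two users (user 1 is `0 : Fin 2`, user 2 is `1 : Fin 2`) -/

/-- `R₁(ω)`: the sum of `ℙ[L₁ ≥ ℓ]` over the levels with `ω ℙ[L₁ ≥ ℓ] ≥ ℙ[L₂ ≥ ℓ]`. -/
noncomputable def R₁ {B : ℕ} (P : PMF (Fin 2 → Fin (B + 1))) (ω : ℝ) : ℝ :=
  ∑ ℓ ∈ Finset.Icc 1 B, if ω * ccdf P 0 ℓ ≥ ccdf P 1 ℓ then ccdf P 0 ℓ else 0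

/-- `R₂(ω)`: the sum of `ℙ[L₂ ≥ ℓ]` over the levels with `ω ℙ[L₁ ≥ ℓ] < ℙ[L₂ ≥ ℓ]`. -/
noncomputable def R₂ {B : ℕ} (P : PMF (Fin 2 → Fin (B + 1))) (ω : ℝ) : ℝ :=
  ∑ ℓ ∈ Finset.Icc 1 B, if ω * ccdf P 0 ℓ < ccdf P 1 ℓ then ccdf P 1 ℓ else 0

/-- The optimal rate for `0 ≤ μ ≤ 1/2`. -/
noncomputable def fStarSmall {B : ℕ} (P : PMF (Fin 2 → Fin (B + 1))) (μ : ℝ) : ℝ :=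
  min
    (⨅ ω : Set.Ici (1 : ℝ),
      ((ω : ℝ) * R₁ P ω + R₂ P ω) / ((ω : ℝ) * (1 - μ) + (1 - 2 * μ)))
    (⨅ ω : Set.Ioc (0 : ℝ) 1,
      (R₁ P ω + 1 / (ω : ℝ) * R₂ P ω) / ((1 - 2 * μ) + 1 / (ω : ℝ) * (1 - μ)))

/-- The optimal rate for `1/2 ≤ μ < 1`. -/
noncomputable def fStarLarge {B : ℕ} (P : PMF (Fin 2 → Fin (B + 1))) (μ : ℝ) : ℝ :=
  min ((∑ ℓ ∈ Finset.Icc 1 B, ccdf P 0 ℓ) / (1 - μ))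
    ((∑ ℓ ∈ Finset.Icc 1 B, ccdf P 1 ℓ) / (1 - μ))

end DTVBC

/-! Converse. For a user `k`, let `h S` be the entropy of the channel inputs in the slots `S` given
the cache of `k` and its requested file (`Code.residual`), and write `Y_k` for the set of slots that
`k` receives. Up to `o(n)`, Fano's inequality at `k` gives `F (1 - μ) + h(Y_k) ≤ |Y_k|`. Fano's
inequality at the other user `k'`, to whom a genie hands the cache and the file of `k`, gives `F (1
- 2μ) ≤ h(Y_k')`, because at least that many bits of the second file lie in neither cache. Adding `ω
≥ 1` times the first bound to the second leaves the mean of `h(Y_k') - ω h(Y_k)` to be bounded.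

This is the heart of the converse, `iidMean_received_sub_le`, and it needs of `h` only that it is a
polymatroid rank function with increments at most one. Replacing the observation of `k` by that of
`k'` one channel use at a time compares both users in one common context, independent of the current
state. Averaging over that state weights the increment of each level by the ccdfs, so each level
contributes at most `max (ω F_k) F_k' - ω F_k`. The sum of these maxima is `ω R₁ + R₂`; exchanging
the users gives the second infimum. For `μ ≥ 1/2` the first Fano bound alone suffices.

Achievability. Bits cached by nobody go into a private stream of their user. Bits cached by the
other user only are added over `𝔽₂`, one from each requested file, into a common stream; each user
cancels the foreign summand from its cache. Slots are shared among the three streams, and each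
stream is coded at random: it is decodable once the number of received slots exceeds the message
length by a linear margin (`iidMean_collision_le`).

Which stream rates are possible is a linear programme in the fractions of the levels. Separation of
convex sets reduces it to one inequality for each vector of four weights
(`exists_allocation_of_forall_weights`), and `weighted_rates_le` deduces all of these from the
inequalities with two weights that define `f⋆`. -/

namespace DTVBC

/-! ### Product measures and Chebyshev's inequality -/

section IidMean

variable {α : Type*} [Fintype α] {n : ℕ} {p : α → ℝ}

/-- The expectation of `φ` under the product of `n` copies of the weights `p`. -/
noncomputable def iidMean (p : α → ℝ) {n : ℕ} (φ : (Fin n → α) → ℝ) : ℝ :=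
  ∑ s, (∏ t, p (s t)) * φ s

lemma iidMean_const (hp : ∑ a, p a = 1) (c : ℝ) : iidMean p (fun _ : Fin n → α => c) = c := by
  classical
  have h := Finset.prod_univ_sum (fun _ : Fin n => (Finset.univ : Finset α)) (fun _ a => p a)
  simp only [hp, Finset.prod_const_one, Fintype.piFinset_univ] at h
  simp only [iidMean, ← Finset.sum_mul, ← h, one_mul]

lemma iidMean_add (φ ψ : (Fin n → α) → ℝ) :
    iidMean p (fun s => φ s + ψ s) = iidMean p φ + iidMean p ψ := by
  simp only [iidMean, mul_add, Finset.sum_add_distrib]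

lemma iidMean_sub (φ ψ : (Fin n → α) → ℝ) :
    iidMean p (fun s => φ s - ψ s) = iidMean p φ - iidMean p ψ := by
  simp only [iidMean, mul_sub, Finset.sum_sub_distrib]

lemma iidMean_const_mul (c : ℝ) (φ : (Fin n → α) → ℝ) :
    iidMean p (fun s => c * φ s) = c * iidMean p φ := by
  simp only [iidMean, Finset.mul_sum, mul_left_comm]

lemma iidMean_sum {ι : Type*} (S : Finset ι) (φ : ι → (Fin n → α) → ℝ) :
    iidMean p (fun s => ∑ i ∈ S, φ i s) = ∑ i ∈ S, iidMean p (φ i) := by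
  simp only [iidMean, Finset.mul_sum]
  exact Finset.sum_comm

lemma iidMean_mono (hp : ∀ a, 0 ≤ p a) {φ ψ : (Fin n → α) → ℝ} (h : ∀ s, φ s ≤ ψ s) :
    iidMean p φ ≤ iidMean p ψ :=
  Finset.sum_le_sum fun s _ => mul_le_mul_of_nonneg_left (h s) (Finset.prod_nonneg fun _ _ => hp _)

/-- Resampling one coordinate does not change the expectation. -/
lemma iidMean_update (hp : ∑ a, p a = 1) (t : Fin n) (φ : (Fin n → α) → ℝ) :
    iidMean p φ = iidMean p (fun s => ∑ a, p a * φ (Function.update s t a)) := by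
  classical
  have key : ∀ (s : Fin n → α) (a : α),
      (∏ i, p (Function.update s t a i)) * p (s t) = (∏ i, p (s i)) * p a := by
    intro s a
    rw [← Finset.mul_prod_erase _ _ (Finset.mem_univ t),
      ← Finset.mul_prod_erase Finset.univ (fun i => p (s i)) (Finset.mem_univ t)]
    have : ∏ i ∈ Finset.univ.erase t, p (Function.update s t a i) =
        ∏ i ∈ Finset.univ.erase t, p (s i) :=
      Finset.prod_congr rfl fun i hi => by
        rw [Function.update_of_ne (Finset.ne_of_mem_erase hi)]
    rw [this, Function.update_self]
    ring
  -- Exchanging coordinate `t` with an independent fresh sample preserves the joint weight.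
  have hinv : Function.Involutive
      (fun q : (Fin n → α) × α => (Function.update q.1 t q.2, q.1 t)) := by
    rintro ⟨s, a⟩
    simp
  calc iidMean p φ = ∑ q : (Fin n → α) × α, ((∏ i, p (q.1 i)) * p q.2) * φ q.1 := by
        rw [Fintype.sum_prod_type]
        refine Finset.sum_congr rfl fun s _ => ?_
        simp only [← Finset.sum_mul, ← Finset.mul_sum, hp, mul_one]
    _ = ∑ q : (Fin n → α) × α, ((∏ i, p (q.1 i)) * p q.2) * φ (Function.update q.1 t q.2) := by
        refine Fintype.sum_equiv hinv.toPerm _ _ fun q => ?_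
        simp only [Function.Involutive.coe_toPerm, Function.update_idem,
          Function.update_eq_self]
        rw [key]
    _ = _ := by
        rw [Fintype.sum_prod_type]
        refine Finset.sum_congr rfl fun s _ => ?_
        rw [Finset.mul_sum]
        exact Finset.sum_congr rfl fun a _ => by ring

lemma iidMean_coord (hp : ∑ a, p a = 1) (t : Fin n) (g : α → ℝ) :
    iidMean p (fun s => g (s t)) = ∑ a, p a * g a := by
  rw [iidMean_update hp t]
  simp only [Function.update_self]
  exact iidMean_const hp _

/-- The second moment of a sum of independent centred variables. -/
lemma iidMean_sum_sq (hp : ∑ a, p a = 1) (g : Fin n → α → ℝ) (hg : ∀ t, ∑ a, p a * g t a = 0) :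
    iidMean p (fun s => (∑ t, g t (s t)) ^ 2) = ∑ t, ∑ a, p a * g t a ^ 2 := by
  simp only [sq, Finset.sum_mul_sum]
  rw [iidMean_sum]
  refine Finset.sum_congr rfl fun t _ => ?_
  rw [iidMean_sum, Finset.sum_eq_single t]
  · exact iidMean_coord hp t fun a => g t a * g t a
  · intro u _ hu
    rw [iidMean_update hp t]
    simp only [Function.update_self, Function.update_of_ne hu, ← mul_assoc, ← Finset.sum_mul, hg,
      zero_mul]
    exact iidMean_const hp _
  · simp

/-- Chebyshev's inequality for the lower tail of a sum of independent variables. -/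
lemma iidMean_lower_tail (hp0 : ∀ a, 0 ≤ p a) (hp : ∑ a, p a = 1) (g : Fin n → α → ℝ) {b : ℝ}
    (hg : ∀ t a, 0 ≤ g t a ∧ g t a ≤ b) {m δ : ℝ} (hδ : 0 < δ) (hn : 0 < n)
    (hm : m + δ * n ≤ ∑ t, ∑ a, p a * g t a) :
    iidMean p (fun s => if ∑ t, g t (s t) < m then 1 else 0) ≤ b ^ 2 / (δ ^ 2 * n) := by
  have hn' : (0 : ℝ) < n := by exact_mod_cast hn
  set e : Fin n → ℝ := fun t => ∑ a, p a * g t a with he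
  have hmean : ∀ t, 0 ≤ e t ∧ e t ≤ b := by
    intro t
    refine ⟨Finset.sum_nonneg fun a _ => mul_nonneg (hp0 a) (hg t a).1, ?_⟩
    calc e t ≤ ∑ a, p a * b :=
          Finset.sum_le_sum fun a _ => mul_le_mul_of_nonneg_left (hg t a).2 (hp0 a)
      _ = b := by rw [← Finset.sum_mul, hp, one_mul]
  have hsq := iidMean_sum_sq hp (fun t a => g t a - e t) (fun t => by
    simp only [mul_sub, Finset.sum_sub_distrib, ← Finset.sum_mul, hp, he]; ring)
  have hbound : ∑ t, ∑ a, p a * (g t a - e t) ^ 2 ≤ n * b ^ 2 := by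
    calc ∑ t, ∑ a, p a * (g t a - e t) ^ 2 ≤ ∑ _t : Fin n, ∑ a, p a * b ^ 2 := by
          refine Finset.sum_le_sum fun t _ => Finset.sum_le_sum fun a _ =>
            mul_le_mul_of_nonneg_left ?_ (hp0 a)
          have := hg t a
          have := hmean t
          apply sq_le_sq'
          · linarith
          · linarith
      _ = n * b ^ 2 := by simp [← Finset.sum_mul, hp]
  have hpt : ∀ s : Fin n → α, (δ * n) ^ 2 * (if ∑ t, g t (s t) < m then (1 : ℝ) else 0) ≤
      (∑ t, (g t (s t) - e t)) ^ 2 := by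
    intro s
    split_ifs with h
    · rw [mul_one, ← neg_sq (∑ t, (g t (s t) - e t))]
      apply pow_le_pow_left₀ (by positivity)
      rw [Finset.sum_sub_distrib]
      linarith
    · rw [mul_zero]
      positivity
  have h1 := iidMean_mono hp0 hpt
  rw [iidMean_const_mul, hsq] at h1
  rw [le_div_iff₀ (by positivity)]
  have h2 := h1.trans hbound
  have h3 : (iidMean p (fun s => if ∑ t, g t (s t) < m then (1 : ℝ) else 0) * (δ ^ 2 * n)) * n ≤
      b ^ 2 * n := by nlinarith
  exact le_of_mul_le_mul_right h3 hn'

end IidMean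

/-! ### The shift channel and its state statistics -/

section Channel

lemma shiftMatrix_pow_mulVec {B : ℕ} (k : ℕ) (X : Fin B → ZMod 2) (i : Fin B) :
    (shiftMatrix B ^ k).mulVec X i =
      if h : k ≤ (i : ℕ) then X ⟨i - k, by omega⟩ else 0 := by
  induction k generalizing i with
  | zero => simp
  | succ k ih =>
    rw [pow_succ', ← Matrix.mulVec_mulVec]
    simp only [Matrix.mulVec, dotProduct, shiftMatrix, Matrix.of_apply, ite_mul, one_mul, zero_mul]
    by_cases h : k + 1 ≤ (i : ℕ)
    · rw [Finset.sum_eq_single (⟨i - 1, by omega⟩ : Fin B)]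
      · have := ih ⟨i - 1, by omega⟩
        simp only [Matrix.mulVec, dotProduct, shiftMatrix] at this
        rw [if_pos (by simp only; omega), this, dif_pos (by omega), dif_pos h]
        congr 2
        omega
      · intro j _ hj
        rw [if_neg]
        intro hij
        exact hj (Fin.ext (by simp only; omega))
      · simp
    · rw [dif_neg h]
      refine Finset.sum_eq_zero fun j _ => ?_
      split_ifs with hij
      · have := ih j
        simp only [Matrix.mulVec, dotProduct, shiftMatrix] at this
        rw [this, dif_neg (by omega)]
      · rfl

/-- Two inputs give the same output in state `ℓ` iff their first `ℓ` bits agree. -/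
lemma channelOutput_eq_iff {B : ℕ} (ℓ : Fin (B + 1)) (X Y : Fin B → ZMod 2) :
    channelOutput ℓ X = channelOutput ℓ Y ↔ ∀ i : Fin B, (i : ℕ) < ℓ → X i = Y i := by
  constructor
  · intro h i hi
    have := congrFun h ⟨i + (B - ℓ), by omega⟩
    simp only [channelOutput, shiftMatrix_pow_mulVec] at this
    simpa using this
  · intro h
    funext i
    simp only [channelOutput, shiftMatrix_pow_mulVec]
    split_ifs with hi
    · exact h _ (by simp only; omega)
    · rfl

/-- The slots (channel use, level) that user `k` receives. -/
def received {K B n : ℕ} (s : Fin n → Fin K → Fin (B + 1)) (k : Fin K) :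
    Finset (Fin n × Fin B) :=
  Finset.univ.filter fun q => (q.2 : ℕ) < s q.1 k

lemma sum_pmf {K B : ℕ} (P : PMF (Fin K → Fin (B + 1))) : ∑ a, (P a).toReal = 1 := by
  rw [← ENNReal.toReal_sum fun a _ => P.apply_ne_top a, ← tsum_fintype (L := .unconditional _),
    P.tsum_coe]
  rfl

lemma ccdf_eq_sum {K B : ℕ} (P : PMF (Fin K → Fin (B + 1))) (k : Fin K) (i : ℕ) :
    ccdf P k (i + 1) = ∑ a, (P a).toReal * (if i < (a k : ℕ) then 1 else 0) := by
  simp [ccdf]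

lemma ccdf_nonneg {K B : ℕ} (P : PMF (Fin K → Fin (B + 1))) (k : Fin K) (ℓ : ℕ) :
    0 ≤ ccdf P k ℓ :=
  Finset.sum_nonneg fun a _ => by split_ifs <;> simp

lemma sum_Icc_levels (B : ℕ) (g : ℕ → ℝ) :
    ∑ ℓ ∈ Finset.Icc 1 B, g ℓ = ∑ i : Fin B, g (i + 1) := by
  rw [Fin.sum_univ_eq_sum_range (fun i => g (i + 1)), Finset.range_eq_Ico,
    Finset.sum_Ico_add' g 0 B 1]
  rfl

end Channel

/-! ### Entropy of partitions of a finite uniform space -/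

section Entropy

open scoped Classical in
/-- The size of the class of `ω`. -/
noncomputable def classSize {Ω : Type*} [Fintype Ω] (r : Setoid Ω) (ω : Ω) : ℝ :=
  (Finset.univ.filter fun v => r ω v).card

/-- The entropy, in bits, of the class of a uniformly distributed point of `Ω`. -/
noncomputable def ent {Ω : Type*} [Fintype Ω] (r : Setoid Ω) : ℝ :=
  (∑ ω, Real.logb 2 (Fintype.card Ω / classSize r ω)) / Fintype.card Ω

variable {Ω : Type*} [Fintype Ω]

lemma classSize_pos (r : Setoid Ω) (ω : Ω) : 0 < classSize r ω := by
  classical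
  unfold classSize
  exact_mod_cast Finset.card_pos.2 ⟨ω, by simp⟩

lemma classSize_mono {r s : Setoid Ω} (h : r ≤ s) (ω : Ω) : classSize r ω ≤ classSize s ω := by
  classical
  unfold classSize
  exact_mod_cast Finset.card_le_card
    (Finset.monotone_filter_right _ fun v _ hv => h hv)

lemma ent_sub_ent [Nonempty Ω] (r s : Setoid Ω) :
    ent r - ent s = (∑ ω, Real.logb 2 (classSize s ω / classSize r ω)) / Fintype.card Ω := by
  have hc : (Fintype.card Ω : ℝ) ≠ 0 := by exact_mod_cast Fintype.card_ne_zero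
  rw [ent, ent, ← sub_div, ← Finset.sum_sub_distrib]
  congr 1
  refine Finset.sum_congr rfl fun ω _ => ?_
  have h1 := (classSize_pos r ω).ne'
  have h2 := (classSize_pos s ω).ne'
  rw [Real.logb_div hc h1, Real.logb_div hc h2, Real.logb_div h2 h1]
  ring

lemma ent_anti [Nonempty Ω] {r s : Setoid Ω} (h : r ≤ s) : ent s ≤ ent r := by
  rw [← sub_nonneg, ent_sub_ent]
  refine div_nonneg (Finset.sum_nonneg fun ω _ => Real.logb_nonneg one_lt_two ?_) (by positivity)
  rw [one_le_div (classSize_pos r ω)]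
  exact classSize_mono h ω

/-- Gibbs' inequality: the conditional entropy of `f` given `t` is at most the cross entropy
relative to any conditional (sub)distribution `q`. -/
lemma ent_inf_ker_sub_le [Nonempty Ω] {A : Type*} [Fintype A] (t : Setoid Ω) (f : Ω → A)
    (q : Ω → A → ℝ) (hq0 : ∀ ω a, 0 ≤ q ω a) (hqpos : ∀ ω, 0 < q ω (f ω))
    (hq1 : ∀ ω, ∑ a, q ω a ≤ 1) (hqt : ∀ ω v, t ω v → q ω = q v) :
    ent (t ⊓ Setoid.ker f) - ent t ≤ (∑ ω, -Real.logb 2 (q ω (f ω))) / Fintype.card Ω := by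
  classical
  set r := t ⊓ Setoid.ker f with hr
  have hclass : ∀ v ω, t v ω → classSize r ω =
      ((Finset.univ.filter fun u => t v u).filter fun u => f u = f ω).card := by
    intro v ω hv
    unfold classSize
    congr 2
    ext u
    simp only [Finset.mem_filter, Finset.mem_univ, true_and]
    constructor
    · rintro ⟨h1, h2⟩
      exact ⟨t.trans hv h1, h2.symm⟩
    · rintro ⟨h1, h2⟩
      exact ⟨t.trans (t.symm hv) h1, h2.symm⟩
  -- The likelihood ratio of `q` to the true conditional law has mean at most one: spread each term
  -- evenly over its `t`-class, exchange the sums and group by the values of `f`. The bound `log x ≤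
  -- x - 1` then finishes.
  have hmain : ∑ ω, q ω (f ω) * classSize t ω / classSize r ω ≤ Fintype.card Ω := by
    calc ∑ ω, q ω (f ω) * classSize t ω / classSize r ω
        = ∑ ω, ∑ v, if t v ω then q v (f ω) / classSize r ω else 0 := by
          refine Finset.sum_congr rfl fun ω _ => ?_
          rw [← Finset.sum_filter]
          have : ∀ v ∈ Finset.univ.filter fun v => t v ω,
              q v (f ω) / classSize r ω = q ω (f ω) / classSize r ω := by
            intro v hv
            rw [hqt v ω (Finset.mem_filter.1 hv).2]
          rw [Finset.sum_congr rfl this, Finset.sum_const, nsmul_eq_mul]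
          have h2 : (Finset.univ.filter fun v => t v ω) = Finset.univ.filter fun v => t ω v := by
            ext v
            simp only [Finset.mem_filter, Finset.mem_univ, true_and]
            exact ⟨fun h => t.symm h, fun h => t.symm h⟩
          rw [h2]
          change _ = classSize t ω * _
          ring
      _ = ∑ v, ∑ ω, if t v ω then q v (f ω) / classSize r ω else 0 := Finset.sum_comm
      _ ≤ ∑ _v : Ω, 1 := by
          refine Finset.sum_le_sum fun v _ => ?_
          rw [← Finset.sum_filter, ← Finset.sum_fiberwise _ f]
          refine le_trans (Finset.sum_le_sum fun a _ => ?_) (hq1 v)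
          have : ∀ ω ∈ (Finset.univ.filter fun u => t v u).filter fun u => f u = a,
              q v (f ω) / classSize r ω = q v a /
                ((Finset.univ.filter fun u => t v u).filter fun u => f u = a).card := by
            intro ω hω
            rw [Finset.mem_filter, Finset.mem_filter] at hω
            rw [hclass v ω hω.1.2, hω.2]
          rw [Finset.sum_congr rfl this, Finset.sum_const, nsmul_eq_mul]
          rcases Nat.eq_zero_or_pos
            ((Finset.univ.filter fun u => t v u).filter fun u => f u = a).card with h0 | h0
          · rw [h0]
            simpa using hq0 v a
          · rw [mul_div_cancel₀]
            exact_mod_cast h0.ne'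
      _ = Fintype.card Ω := by simp
  rw [ent_sub_ent, ← sub_nonpos, ← sub_div, ← Finset.sum_sub_distrib]
  refine div_nonpos_of_nonpos_of_nonneg ?_ (by positivity)
  have hlog : (0 : ℝ) < Real.log 2 := Real.log_pos one_lt_two
  calc ∑ ω, (Real.logb 2 (classSize t ω / classSize r ω) - -Real.logb 2 (q ω (f ω)))
      ≤ ∑ ω, (q ω (f ω) * classSize t ω / classSize r ω - 1) / Real.log 2 := by
        refine Finset.sum_le_sum fun ω _ => ?_
        have h1 := classSize_pos r ω
        have h2 := classSize_pos t ω
        have h3 := hqpos ω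
        rw [sub_neg_eq_add, ← Real.logb_mul (by positivity) h3.ne', Real.logb]
        refine div_le_div_of_nonneg_right ?_ hlog.le
        rw [show classSize t ω / classSize r ω * q ω (f ω) =
          q ω (f ω) * classSize t ω / classSize r ω by ring]
        exact Real.log_le_sub_one_of_pos (by positivity)
    _ = (∑ ω, q ω (f ω) * classSize t ω / classSize r ω - Fintype.card Ω) / Real.log 2 := by
        rw [← Finset.sum_div, Finset.sum_sub_distrib]
        simp
    _ ≤ 0 := div_nonpos_of_nonpos_of_nonneg (by linarith) hlog.le

/-- Conditioning reduces entropy. -/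
lemma ent_inf_sub_le [Nonempty Ω] {b c : Setoid Ω} (a : Setoid Ω) (h : b ≤ c) :
    ent (b ⊓ a) - ent b ≤ ent (c ⊓ a) - ent c := by
  classical
  have hker : Setoid.ker (Quotient.mk a) = a := Setoid.ker_mk_eq a
  have hsize : ∀ ω, ((Finset.univ.filter fun v => c ω v).filter
      fun v => Quotient.mk a v = Quotient.mk a ω).card = classSize (c ⊓ a) ω := by
    intro ω
    unfold classSize
    congr 2
    ext v
    simp only [Finset.mem_filter, Finset.mem_univ, true_and, Quotient.eq]
    exact and_congr_right fun _ => ⟨fun h => a.symm h, fun h => a.symm h⟩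
  -- Gibbs' inequality with `q` the true conditional law of the `a`-class given the coarser `c`; its
  -- cross entropy is exactly the right-hand side.
  have key := ent_inf_ker_sub_le b (Quotient.mk a)
    (fun ω α => (((Finset.univ.filter fun v => c ω v).filter
      fun v => Quotient.mk a v = α).card : ℝ) / classSize c ω)
    (fun ω α => div_nonneg (by positivity) (classSize_pos c ω).le)
    (fun ω => by
      rw [hsize]
      exact div_pos (classSize_pos _ ω) (classSize_pos c ω))
    (fun ω => by
      rw [← Finset.sum_div, div_le_one (classSize_pos c ω), classSize, ← Nat.cast_sum,
        ← Finset.card_eq_sum_card_fiberwise fun _ _ => Finset.mem_coe.2 (Finset.mem_univ _)])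
    (fun ω v hb => by
      have : (Finset.univ.filter fun u => c ω u) = Finset.univ.filter fun u => c v u := by
        ext u
        simp only [Finset.mem_filter, Finset.mem_univ, true_and]
        exact ⟨fun h' => c.trans (c.symm (h hb)) h', fun h' => c.trans (h hb) h'⟩
      funext α
      rw [classSize, classSize, this])
  rw [hker] at key
  refine key.trans_eq ?_
  rw [ent_sub_ent]
  congr 1
  refine Finset.sum_congr rfl fun ω _ => ?_
  simp only [hsize]
  rw [← Real.logb_inv, inv_div]

/-- A bit has entropy at most one. -/
lemma ent_inf_ker_bit_le [Nonempty Ω] (t : Setoid Ω) (f : Ω → ZMod 2) :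
    ent (t ⊓ Setoid.ker f) ≤ ent t + 1 := by
  have key := ent_inf_ker_sub_le t f (fun _ _ => 1 / 2) (fun _ _ => by norm_num)
    (fun _ => by norm_num) (fun _ => by simp [ZMod.card]) (fun _ _ _ => rfl)
  have h : -Real.logb 2 (1 / 2) = 1 := by
    rw [one_div, Real.logb_inv, neg_neg, Real.logb_self_eq_one one_lt_two]
  have hc : (Fintype.card Ω : ℝ) ≠ 0 := by exact_mod_cast Fintype.card_ne_zero
  simp only [h, Finset.sum_const, Finset.card_univ, nsmul_eq_mul, mul_one, div_self hc] at key
  linarith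

/-- Fano's inequality. -/
lemma ent_inf_ker_fano [Nonempty Ω] {A : Type*} [Fintype A] [DecidableEq A] (t : Setoid Ω)
    (f g : Ω → A) (hg : t ≤ Setoid.ker g) {F : ℕ} (hA : Fintype.card A = 2 ^ F) :
    ent (t ⊓ Setoid.ker f) ≤ ent t + 1 +
      F * (∑ ω, if g ω ≠ f ω then (Fintype.card Ω : ℝ)⁻¹ else 0) := by
  have hc : (Fintype.card Ω : ℝ) ≠ 0 := by exact_mod_cast Fintype.card_ne_zero
  have hF : (0 : ℝ) < 1 / (2 * 2 ^ F) := by positivity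
  -- Here `q` puts mass `1/2` on the guess and `1 / (2 * 2 ^ F)` on every other value. A correct
  -- guess costs one bit and a wrong one `1 + F`, so no binary entropy function is needed.
  have key := ent_inf_ker_sub_le t f
    (fun ω a => (if g ω = a then 1 / 2 - 1 / (2 * 2 ^ F) else 0) + 1 / (2 * 2 ^ F))
    (fun ω a => by
      have : (1 : ℝ) / (2 * 2 ^ F) ≤ 1 / 2 := by
        apply one_div_le_one_div_of_le (by norm_num)
        have : (1 : ℝ) ≤ 2 ^ F := one_le_pow₀ (by norm_num)
        linarith
      split_ifs <;> linarith)
    (fun ω => by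
      have : (1 : ℝ) / (2 * 2 ^ F) ≤ 1 / 2 := by
        apply one_div_le_one_div_of_le (by norm_num)
        have : (1 : ℝ) ≤ 2 ^ F := one_le_pow₀ (by norm_num)
        linarith
      split_ifs <;> linarith)
    (fun ω => by
      rw [Finset.sum_add_distrib, Finset.sum_ite_eq, if_pos (Finset.mem_univ _), Finset.sum_const,
        Finset.card_univ, hA, nsmul_eq_mul]
      push_cast
      have : (2 : ℝ) ^ F * (1 / (2 * 2 ^ F)) = 1 / 2 := by field_simp
      linarith)
    (fun ω v h => by
      have : g ω = g v := hg h
      simp only [this])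
  have hval : ∀ ω, -Real.logb 2 ((if g ω = f ω then (1 : ℝ) / 2 - 1 / (2 * 2 ^ F) else 0) +
      1 / (2 * 2 ^ F)) = 1 + F * (if g ω ≠ f ω then 1 else 0) := by
    intro ω
    by_cases h : g ω = f ω
    · simp only [h, if_true, ne_eq, not_true, if_false, sub_add_cancel, mul_zero, add_zero]
      rw [one_div, Real.logb_inv, neg_neg, Real.logb_self_eq_one one_lt_two]
    · simp only [h, if_false, ne_eq, not_false_iff, if_true, zero_add, mul_one]
      rw [one_div, Real.logb_inv, neg_neg, Real.logb_mul (by norm_num) (by positivity),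
        Real.logb_self_eq_one one_lt_two, Real.logb_pow, Real.logb_self_eq_one one_lt_two, mul_one]
  simp only [hval] at key
  rw [Finset.sum_add_distrib, add_div, Finset.sum_const, Finset.card_univ, nsmul_eq_mul, mul_one,
    div_self hc, ← Finset.mul_sum] at key
  have h2 : (∑ ω, if g ω ≠ f ω then (Fintype.card Ω : ℝ)⁻¹ else 0) =
      (∑ ω, if g ω ≠ f ω then (1 : ℝ) else 0) / Fintype.card Ω := by
    rw [Finset.sum_div]
    exact Finset.sum_congr rfl fun ω _ => by split_ifs <;> simp
  rw [h2, ← mul_div_assoc]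
  linarith

end Entropy

/-! ### Entropy of families of bits -/

section Observation

variable {Ω ι : Type*} (x : Ω → ι → ZMod 2)

/-- Two points are equivalent when the bits with indices in `S` agree. -/
def obs (S : Finset ι) : Setoid Ω where
  r ω v := ∀ i ∈ S, x ω i = x v i
  iseqv := ⟨fun _ _ _ => rfl, fun h i hi => (h i hi).symm,
    fun h h' i hi => (h i hi).trans (h' i hi)⟩

lemma obs_iff {S : Finset ι} {ω v : Ω} : obs x S ω v ↔ ∀ i ∈ S, x ω i = x v i := Iff.rfl

lemma obs_anti {S T : Finset ι} (h : S ⊆ T) : obs x T ≤ obs x S :=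
  fun {_ _} hv i hi => hv i (h hi)

lemma obs_empty : obs x ∅ = ⊤ := by
  ext ω v
  simp [obs_iff, Setoid.top_def]

variable [DecidableEq ι]

lemma obs_union (S T : Finset ι) : obs x (S ∪ T) = obs x S ⊓ obs x T := by
  ext ω v
  simp only [obs_iff, Setoid.inf_iff_and, Finset.mem_union]
  exact ⟨fun h => ⟨fun i hi => h i (Or.inl hi), fun i hi => h i (Or.inr hi)⟩,
    fun h i hi => hi.elim (h.1 i) (h.2 i)⟩

lemma obs_insert (i : ι) (S : Finset ι) :
    obs x (insert i S) = obs x S ⊓ Setoid.ker fun ω => x ω i := by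
  ext ω v
  simp only [obs_iff, Setoid.inf_iff_and, Finset.mem_insert, forall_eq_or_imp, Setoid.ker_def]
  exact and_comm

variable [Fintype Ω] [Nonempty Ω]

lemma ent_inf_obs_insert_le (t : Setoid Ω) (i : ι) (S : Finset ι) :
    ent (t ⊓ obs x (insert i S)) ≤ ent (t ⊓ obs x S) + 1 := by
  rw [obs_insert, ← inf_assoc]
  exact ent_inf_ker_bit_le _ _

lemma ent_inf_obs_union_le (t : Setoid Ω) (S T : Finset ι) :
    ent (t ⊓ obs x (S ∪ T)) ≤ ent (t ⊓ obs x S) + T.card := by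
  induction T using Finset.induction_on with
  | empty => simp
  | insert i T hi ih =>
    rw [Finset.union_insert, Finset.card_insert_of_notMem hi]
    push_cast
    linarith [ent_inf_obs_insert_le x t i (S ∪ T)]

lemma ent_inf_obs_le (t : Setoid Ω) (T : Finset ι) : ent (t ⊓ obs x T) ≤ ent t + T.card := by
  have := ent_inf_obs_union_le x t ∅ T
  rwa [Finset.empty_union, obs_empty, inf_top_eq] at this

lemma ent_top : ent (⊤ : Setoid Ω) = 0 := by
  classical
  have hc : (Fintype.card Ω : ℝ) ≠ 0 := by exact_mod_cast Fintype.card_ne_zero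
  have : ∀ ω : Ω, classSize ⊤ ω = Fintype.card Ω := by
    intro ω
    simp [classSize, Setoid.top_def]
  simp [ent, this]

lemma ent_bot : ent (⊥ : Setoid Ω) = Real.logb 2 (Fintype.card Ω) := by
  classical
  have hc : (Fintype.card Ω : ℝ) ≠ 0 := by exact_mod_cast Fintype.card_ne_zero
  have : ∀ ω : Ω, classSize ⊥ ω = 1 := by
    intro ω
    simp [classSize, Finset.filter_eq]
  simp [ent, this, hc]

/-- Independent uniform bits: the entropy of a collection of them is their number. -/
lemma ent_obs_eq_card [Fintype ι] (hx : Function.Injective x)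
    (hcard : Fintype.card Ω = 2 ^ Fintype.card ι) (S : Finset ι) : ent (obs x S) = S.card := by
  -- The bits in `S` and those in `Sᶜ` contribute at most `S.card` and `Sᶜ.card`, while the total is
  -- exactly `card ι`; hence equality.
  have h1 := ent_inf_obs_le x ⊤ S
  have h2 := ent_inf_obs_union_le x ⊤ S Sᶜ
  have h3 : obs x Finset.univ = ⊥ := by
    ext ω v
    simp only [obs_iff, Finset.mem_univ, true_implies, Setoid.bot_def]
    exact ⟨fun h => hx (funext h), fun h i => by rw [h]⟩
  have h4 : ((S.card : ℕ) : ℝ) + (Sᶜ.card : ℕ) = Fintype.card ι := by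
    exact_mod_cast Finset.card_add_card_compl S
  rw [Finset.union_compl, h3, top_inf_eq, top_inf_eq, ent_bot, hcard, Nat.cast_pow, Real.logb_pow,
    Nat.cast_ofNat, Real.logb_self_eq_one one_lt_two] at h2
  rw [top_inf_eq, ent_top] at h1
  linarith

end Observation

/-! ### The extremal inequality for received slots -/

section Extremal

variable {K B n : ℕ}

/-- The first `ℓ` levels of channel use `t`. -/
def levelBlock (t : Fin n) (ℓ : ℕ) : Finset (Fin n × Fin B) :=
  Finset.univ.filter fun q => q.1 = t ∧ (q.2 : ℕ) < ℓ

/-- What user `k'` receives before `t` together with what user `k` receives after `t`. -/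
def hybridContext (k k' : Fin K) (s : Fin n → Fin K → Fin (B + 1)) (t : Fin n) :
    Finset (Fin n × Fin B) :=
  Finset.univ.filter fun q => (q.1 < t ∧ (q.2 : ℕ) < s q.1 k') ∨ (t < q.1 ∧ (q.2 : ℕ) < s q.1 k)

/-- The context does not depend on the state at `t`; this allows averaging over that state with the
context held fixed. -/
lemma hybridContext_update (k k' : Fin K) (s : Fin n → Fin K → Fin (B + 1)) (t : Fin n)
    (a : Fin K → Fin (B + 1)) :
    hybridContext k k' (Function.update s t a) t = hybridContext k k' s t := by
  ext q
  simp only [hybridContext, Finset.mem_filter, Finset.mem_univ, true_and]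
  by_cases h : q.1 = t
  · simp [h]
  · rw [Function.update_of_ne h]

/-- What user `k'` receives before `m` together with what user `k` receives from `m` on. -/
def hybrid (k k' : Fin K) (s : Fin n → Fin K → Fin (B + 1)) (m : ℕ) : Finset (Fin n × Fin B) :=
  Finset.univ.filter fun q =>
    ((q.1 : ℕ) < m ∧ (q.2 : ℕ) < s q.1 k') ∨ (m ≤ (q.1 : ℕ) ∧ (q.2 : ℕ) < s q.1 k)

/-- What user `k` receives from `m` on. -/
def receivedFrom (k : Fin K) (s : Fin n → Fin K → Fin (B + 1)) (m : ℕ) : Finset (Fin n × Fin B) :=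
  Finset.univ.filter fun q => m ≤ (q.1 : ℕ) ∧ (q.2 : ℕ) < s q.1 k

/-- With `hybrid_castSucc`: consecutive hybrids extend the same context, once by what `k'` and once
by what `k` sees at `t`. -/
lemma hybrid_succ (k k' : Fin K) (s : Fin n → Fin K → Fin (B + 1)) (t : Fin n) :
    hybrid k k' s (t + 1) = hybridContext k k' s t ∪ levelBlock t (s t k') := by
  ext ⟨u, i⟩
  simp only [hybrid, hybridContext, levelBlock, Finset.mem_filter, Finset.mem_univ, true_and,
    Finset.mem_union, Fin.lt_def]
  rcases lt_trichotomy u t with h | rfl | h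
  · have h' := Fin.lt_def.1 h
    have := h.ne
    grind
  · grind
  · have h' := Fin.lt_def.1 h
    have := h.ne'
    grind

lemma hybrid_castSucc (k k' : Fin K) (s : Fin n → Fin K → Fin (B + 1)) (t : Fin n) :
    hybrid k k' s t = hybridContext k k' s t ∪ levelBlock t (s t k) := by
  ext ⟨u, i⟩
  simp only [hybrid, hybridContext, levelBlock, Finset.mem_filter, Finset.mem_univ, true_and,
    Finset.mem_union, Fin.lt_def]
  rcases lt_trichotomy u t with h | rfl | h
  · have h' := Fin.lt_def.1 h
    have := h.ne
    grind
  · grind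
  · have h' := Fin.lt_def.1 h
    have := h.ne'
    grind

lemma receivedFrom_eq (k : Fin K) (s : Fin n → Fin K → Fin (B + 1)) (t : Fin n) :
    receivedFrom k s t = receivedFrom k s (t + 1) ∪ levelBlock t (s t k) := by
  ext ⟨u, i⟩
  simp only [receivedFrom, levelBlock, Finset.mem_filter, Finset.mem_univ, true_and,
    Finset.mem_union]
  rcases lt_trichotomy u t with h | rfl | h
  · have h' := Fin.lt_def.1 h
    have := h.ne
    grind
  · grind
  · have h' := Fin.lt_def.1 h
    have := h.ne'
    grind

lemma receivedFrom_subset (k k' : Fin K) (s : Fin n → Fin K → Fin (B + 1)) (t : Fin n) :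
    receivedFrom k s (t + 1) ⊆ hybridContext k k' s t := by
  intro q
  simp only [receivedFrom, hybridContext, Finset.mem_filter, Finset.mem_univ, true_and,
    Fin.lt_def]
  rintro ⟨h1, h2⟩
  exact Or.inr ⟨by omega, h2⟩

lemma hybrid_zero (k k' : Fin K) (s : Fin n → Fin K → Fin (B + 1)) :
    hybrid k k' s 0 = received s k := by
  simp [hybrid, received]

lemma hybrid_last (k k' : Fin K) (s : Fin n → Fin K → Fin (B + 1)) :
    hybrid k k' s n = received s k' := by
  ext q
  have := q.1.isLt
  simp [hybrid, received]

lemma receivedFrom_zero (k : Fin K) (s : Fin n → Fin K → Fin (B + 1)) :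
    receivedFrom k s 0 = received s k := by
  simp [receivedFrom, received]

lemma receivedFrom_last (k : Fin K) (s : Fin n → Fin K → Fin (B + 1)) :
    receivedFrom k s n = ∅ := by
  ext q
  have := q.1.isLt
  simp [receivedFrom]

/-- The increment of a set function along the first `ℓ` levels, as a sum over the levels. -/
lemma sub_levelBlock_eq_sum (h : Finset (Fin n × Fin B) → ℝ) (U : Finset (Fin n × Fin B))
    (t : Fin n) (ℓ : Fin (B + 1)) :
    h (U ∪ levelBlock t ℓ) - h U = ∑ i : Fin B, (if (i : ℕ) < ℓ then (1 : ℝ) else 0) *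
      (h (U ∪ levelBlock t (i + 1)) - h (U ∪ levelBlock t i)) := by
  have h0 : levelBlock (B := B) t 0 = ∅ := by
    ext q
    simp [levelBlock]
  rw [Fin.sum_univ_eq_sum_range (fun i => (if i < (ℓ : ℕ) then (1 : ℝ) else 0) *
    (h (U ∪ levelBlock t (i + 1)) - h (U ∪ levelBlock t i))) B]
  simp only [ite_mul, one_mul, zero_mul]
  rw [← Finset.sum_filter]
  have : (Finset.range B).filter (fun i => i < (ℓ : ℕ)) = Finset.range ℓ := by
    ext i
    simp only [Finset.mem_filter, Finset.mem_range]
    omega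
  rw [this, Finset.sum_range_sub (fun i => h (U ∪ levelBlock t i)), h0, Finset.union_empty]

variable (P : PMF (Fin K → Fin (B + 1)))

/-- Level `i` counts exactly when the state exceeds `i`, so averaging the telescoped increment turns
the indicators into values of the ccdf. -/
lemma mean_sub_levelBlock (h : Finset (Fin n × Fin B) → ℝ) (U : Finset (Fin n × Fin B))
    (t : Fin n) (k : Fin K) :
    ∑ a, (P a).toReal * (h (U ∪ levelBlock t (a k)) - h U) = ∑ i : Fin B,
      ccdf P k (i + 1) * (h (U ∪ levelBlock t (i + 1)) - h (U ∪ levelBlock t i)) := by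
  simp only [sub_levelBlock_eq_sum h U t, ccdf_eq_sum, Finset.mul_sum, Finset.sum_mul]
  rw [Finset.sum_comm]
  exact Finset.sum_congr rfl fun i _ => Finset.sum_congr rfl fun a _ => by ring

/-- The extremal inequality: for a polymatroid rank function `h` with increments at most one. -/
lemma iidMean_received_sub_le {h : Finset (Fin n × Fin B) → ℝ} (hmono : Monotone h)
    (hempty : h ∅ = 0) (hbit : ∀ q S, h (insert q S) ≤ h S + 1)
    (hsub : ∀ S T C, S ⊆ T → h (T ∪ C) - h T ≤ h (S ∪ C) - h S)
    (k k' : Fin K) {ω : ℝ} (hω : 1 ≤ ω) :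
    iidMean (fun a => (P a).toReal) (fun s : Fin n → _ => h (received s k')) -
      ω * iidMean (fun a => (P a).toReal) (fun s : Fin n → _ => h (received s k)) ≤
    n * ∑ i : Fin B, (max (ω * ccdf P k (i + 1)) (ccdf P k' (i + 1)) - ω * ccdf P k (i + 1)) := by
  set p : (Fin K → Fin (B + 1)) → ℝ := fun a => (P a).toReal
  have hp0 : ∀ a, 0 ≤ p a := fun a => ENNReal.toReal_nonneg
  have hp : ∑ a, p a = 1 := sum_pmf P
  set D : Fin K → Fin n → (Fin n → Fin K → Fin (B + 1)) → ℝ := fun j t s =>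
    h (hybridContext k k' s t ∪ levelBlock t (s t j)) - h (hybridContext k k' s t) with hD
  -- Split the left side as `(h(Y_k') - h(Y_k)) - (ω - 1) h(Y_k)`. The first part telescopes over
  -- the hybrids, and the second needs only a lower bound for `h(Y_k)` because `ω ≥ 1`.
  have hpt : ∀ s, h (received s k') - ω * h (received s k) ≤ ∑ t, (D k' t s - ω * D k t s) := by
    intro s
    have h1 : h (received s k') - h (received s k) = ∑ t, (D k' t s - D k t s) := by
      rw [← hybrid_zero k k' s, ← hybrid_last k k' s, ← Finset.sum_range_sub
        (fun m => h (hybrid k k' s m)), ← Fin.sum_univ_eq_sum_range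
        (fun m => h (hybrid k k' s (m + 1)) - h (hybrid k k' s m))]
      refine Finset.sum_congr rfl fun t _ => ?_
      rw [hybrid_succ, hybrid_castSucc, hD]
      ring
    -- By the chain rule backwards in time, `h(Y_k)` is a sum of increments over the future of `k`
    -- alone. The hybrid context contains that future, so submodularity makes its increments
    -- smaller.
    have h2 : ∑ t, D k t s ≤ h (received s k) := by
      have h3 : h (received s k) =
          ∑ t : Fin n, (h (receivedFrom k s t) - h (receivedFrom k s (t + 1))) := by
        have := Finset.sum_range_sub (fun m => h (receivedFrom k s m)) n
        rw [receivedFrom_last, receivedFrom_zero, hempty, ← Fin.sum_univ_eq_sum_range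
          (fun m => h (receivedFrom k s (m + 1)) - h (receivedFrom k s m))] at this
        rw [← neg_inj, ← Finset.sum_neg_distrib]
        simp only [neg_sub]
        linarith
      rw [h3]
      refine Finset.sum_le_sum fun t _ => ?_
      rw [receivedFrom_eq]
      exact hsub _ _ _ (receivedFrom_subset k k' s t)
    rw [Finset.sum_sub_distrib, ← Finset.mul_sum]
    rw [Finset.sum_sub_distrib] at h1
    nlinarith
  rw [← iidMean_const_mul, ← iidMean_sub]
  refine (iidMean_mono hp0 hpt).trans ?_
  rw [iidMean_sum]
  refine (Finset.sum_le_card_nsmul _ _ (∑ i : Fin B,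
    (max (ω * ccdf P k (i + 1)) (ccdf P k' (i + 1)) - ω * ccdf P k (i + 1)))
    fun t _ => ?_).trans_eq (by simp)
  -- Resampling the state at `t` lets the inner average see a constant context `U`.
  rw [iidMean_update hp t]
  refine (iidMean_mono hp0 fun s => ?_).trans_eq (iidMean_const hp _)
  simp only [hD, hybridContext_update, Function.update_self, mul_sub (p _), mul_left_comm (p _) ω]
  set U := hybridContext k k' s t
  have e1 := mean_sub_levelBlock P h U t k'
  have e2 := mean_sub_levelBlock P h U t k
  have e3 : ∑ a, (p a * h (U ∪ levelBlock t (a k')) - p a * h U -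
      ω * (p a * h (U ∪ levelBlock t (a k)) - p a * h U)) =
      ∑ a, p a * (h (U ∪ levelBlock t (a k')) - h U) -
      ω * ∑ a, p a * (h (U ∪ levelBlock t (a k)) - h U) := by
    rw [Finset.mul_sum, ← Finset.sum_sub_distrib]
    exact Finset.sum_congr rfl fun a _ => by ring
  refine e3.trans_le ?_
  rw [e1, e2, Finset.mul_sum, ← Finset.sum_sub_distrib]
  refine Finset.sum_le_sum fun i _ => ?_
  have hblock : levelBlock t ((i : ℕ) + 1) = insert (t, i) (levelBlock (B := B) t i) := by
    ext ⟨u, j⟩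
    simp only [levelBlock, Finset.mem_filter, Finset.mem_univ, true_and, Finset.mem_insert,
      Prod.mk.injEq, Fin.ext_iff]
    omega
  have hu : U ∪ levelBlock t ((i : ℕ) + 1) = insert (t, i) (U ∪ levelBlock (B := B) t i) := by
    rw [hblock, Finset.union_insert]
  have d0 : 0 ≤ h (U ∪ levelBlock t ((i : ℕ) + 1)) - h (U ∪ levelBlock t i) := by
    rw [sub_nonneg, hu]
    exact hmono (Finset.subset_insert _ _)
  have d1 : h (U ∪ levelBlock t ((i : ℕ) + 1)) - h (U ∪ levelBlock t i) ≤ 1 := by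
    rw [hu]
    linarith [hbit (t, i) (U ∪ levelBlock t i)]
  -- What remains is `(F_k' - ω F_k) δ ≤ max (ω F_k) F_k' - ω F_k` for `δ` in `[0, 1]`.
  generalize h (U ∪ levelBlock t ((i : ℕ) + 1)) - h (U ∪ levelBlock t i) = δ at d0 d1
  have m1 := le_max_left (ω * ccdf P k (i + 1)) (ccdf P k' (i + 1))
  have m2 := le_max_right (ω * ccdf P k (i + 1)) (ccdf P k' (i + 1))
  generalize max (ω * ccdf P k (i + 1)) (ccdf P k' (i + 1)) = M at m1 m2
  nlinarith

lemma mean_card_received (k : Fin K) :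
    iidMean (fun a => (P a).toReal) (fun s : Fin n → _ => ((received s k).card : ℝ)) =
      n * ∑ i : Fin B, ccdf P k (i + 1) := by
  have : ∀ s : Fin n → Fin K → Fin (B + 1), ((received s k).card : ℝ) =
      ∑ t : Fin n, ∑ i : Fin B, if (i : ℕ) < s t k then (1 : ℝ) else 0 := by
    intro s
    rw [← Fintype.sum_prod_type', Finset.sum_boole]
    rfl
  simp only [this]
  rw [iidMean_sum]
  have h2 : ∀ t : Fin n, iidMean (fun a => (P a).toReal) (fun s : Fin n → _ =>
      ∑ i : Fin B, if (i : ℕ) < (s t k : ℕ) then (1 : ℝ) else 0) =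
      ∑ i : Fin B, ccdf P k (i + 1) := by
    intro t
    rw [iidMean_coord (sum_pmf P) t fun a => ∑ i : Fin B, if (i : ℕ) < (a k : ℕ) then (1 : ℝ) else 0]
    simp only [ccdf_eq_sum, Finset.mul_sum]
    exact Finset.sum_comm
  rw [Finset.sum_congr rfl fun t _ => h2 t, Finset.sum_const, Finset.card_univ, Fintype.card_fin,
    nsmul_eq_mul]

end Extremal

/-! ### Upper bound on achievable rates -/

section Converse

variable {K : ℕ} {μ : ℝ}

open scoped Classical in
/-- The bits of a file that user `k` does not cache. -/
noncomputable def CachingStrategy.uncached (c : CachingStrategy K μ) (k : Fin K) (F : ℕ) :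
    Finset (Fin F) :=
  Finset.univ.filter fun j => j ∉ c.cachedBits k F

lemma CachingStrategy.mem_uncached {c : CachingStrategy K μ} {k : Fin K} {F : ℕ} {j : Fin F} :
    j ∈ c.uncached k F ↔ j ∉ c.cachedBits k F := by
  simp [uncached]

lemma card_filter_interval_le {F a b : ℕ} :
    (Finset.univ.filter fun j : Fin F => a ≤ (j : ℕ) ∧ (j : ℕ) < b).card ≤ b - a := by
  rw [← Nat.card_Ico]
  refine Finset.card_le_card_of_injOn (fun j : Fin F => (j : ℕ)) (fun j hj => ?_)
    fun _ _ _ _ h => Fin.ext h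
  simpa using hj

/-- Both endpoints are rounded inwards, so each interval contributes at most its length times `F`,
without an error term. -/
lemma CachingStrategy.card_compl_uncached_le (c : CachingStrategy K μ) (k : Fin K) (F : ℕ) :
    (((c.uncached k F)ᶜ).card : ℝ) ≤ μ * F := by
  classical
  have key : ∀ l : List (ℝ × ℝ), (∀ I ∈ l, I.1 ≤ I.2) →
      ((Finset.univ.filter fun j : Fin F =>
        ∃ I ∈ l, ⌈I.1 * F⌉₊ ≤ (j : ℕ) ∧ (j : ℕ) < ⌊I.2 * F⌋₊).card : ℝ) ≤
      (l.map fun I => I.2 - I.1).sum * F := by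
    intro l
    induction l with
    | nil => simp
    | cons I l ih =>
      intro hl
      have h1 := ih fun J hJ => hl J (List.mem_cons_of_mem _ hJ)
      have h2 := hl I List.mem_cons_self
      have h3 : ((Finset.univ.filter fun j : Fin F =>
          ⌈I.1 * F⌉₊ ≤ (j : ℕ) ∧ (j : ℕ) < ⌊I.2 * F⌋₊).card : ℝ) ≤ (I.2 - I.1) * F := by
        have hF : (0 : ℝ) ≤ F := Nat.cast_nonneg F
        have hle : ((Finset.univ.filter fun j : Fin F =>
          ⌈I.1 * F⌉₊ ≤ (j : ℕ) ∧ (j : ℕ) < ⌊I.2 * F⌋₊).card : ℝ) ≤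
            ((⌊I.2 * F⌋₊ - ⌈I.1 * F⌉₊ : ℕ) : ℝ) := by exact_mod_cast card_filter_interval_le
        refine hle.trans ?_
        rcases le_total ⌊I.2 * F⌋₊ ⌈I.1 * F⌉₊ with h | h
        · rw [Nat.sub_eq_zero_of_le h, Nat.cast_zero]
          exact mul_nonneg (by linarith) hF
        -- The statement about lists does not assume `0 ≤ I.2`, and `⌊·⌋₊` of a negative number is
        -- `0`, which may exceed the number.
        · rcases Nat.eq_zero_or_pos ⌊I.2 * F⌋₊ with h0 | h0
          · rw [h0, Nat.zero_sub, Nat.cast_zero]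
            exact mul_nonneg (by linarith) hF
          · rw [Nat.cast_sub h]
            have h4 : (⌊I.2 * F⌋₊ : ℝ) ≤ I.2 * F :=
              Nat.floor_le (by
                by_contra hneg
                rw [Nat.floor_of_nonpos (by linarith)] at h0
                exact lt_irrefl _ h0)
            have h5 := Nat.le_ceil (I.1 * F)
            linarith
      have h6 : (Finset.univ.filter fun j : Fin F =>
          ∃ J ∈ I :: l, ⌈J.1 * F⌉₊ ≤ (j : ℕ) ∧ (j : ℕ) < ⌊J.2 * F⌋₊) =
          (Finset.univ.filter fun j : Fin F =>
            ⌈I.1 * F⌉₊ ≤ (j : ℕ) ∧ (j : ℕ) < ⌊I.2 * F⌋₊) ∪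
          (Finset.univ.filter fun j : Fin F =>
            ∃ J ∈ l, ⌈J.1 * F⌉₊ ≤ (j : ℕ) ∧ (j : ℕ) < ⌊J.2 * F⌋₊) := by
        ext j
        simp
      rw [h6, List.map_cons, List.sum_cons, add_mul]
      refine le_trans ?_ (add_le_add h3 h1)
      exact_mod_cast Finset.card_union_le _ _
  have := key (c.intervals k) fun I hI => (c.bounds k I hI).2.1
  rw [c.total_length] at this
  convert this using 3
  ext j
  simp [uncached, cachedBits]

lemma CachingStrategy.le_card_uncached (c : CachingStrategy K μ) (k : Fin K) (F : ℕ) :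
    F * (1 - μ) ≤ ((c.uncached k F).card : ℝ) := by
  have h1 := c.card_compl_uncached_le k F
  have h2 : (((c.uncached k F)).card : ℝ) + ((c.uncached k F)ᶜ).card = F := by
    exact_mod_cast (Finset.card_add_card_compl _).trans (Fintype.card_fin F)
  linarith

lemma CachingStrategy.le_card_uncached_inter (c : CachingStrategy K μ) (k k' : Fin K) (F : ℕ) :
    F * (1 - 2 * μ) ≤ ((c.uncached k F ∩ c.uncached k' F).card : ℝ) := by
  have h1 := c.card_compl_uncached_le k F
  have h3 := c.card_compl_uncached_le k' F
  have h2 : (((c.uncached k F ∩ c.uncached k' F)).card : ℝ) +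
      ((c.uncached k F ∩ c.uncached k' F)ᶜ).card = F := by
    exact_mod_cast (Finset.card_add_card_compl _).trans (Fintype.card_fin F)
  have h4 : (((c.uncached k F ∩ c.uncached k' F)ᶜ).card : ℝ) ≤
      ((c.uncached k F)ᶜ).card + ((c.uncached k' F)ᶜ).card := by
    rw [Finset.compl_inter]
    exact_mod_cast Finset.card_union_le _ _
  linarith

/-- All bits of all files, as one family. -/
def fileBits (N F : ℕ) (W : Fin N → Fin F → ZMod 2) (q : Fin N × Fin F) : ZMod 2 := W q.1 q.2

/-- The indices of the bits of file `i`. -/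
def fileSet {N : ℕ} (F : ℕ) (i : Fin N) : Finset (Fin N × Fin F) :=
  Finset.univ.filter fun q => q.1 = i

open scoped Classical in
/-- The indices of the bits that user `k` caches. -/
noncomputable def CachingStrategy.cacheSet (c : CachingStrategy K μ) (k : Fin K) (N F : ℕ) :
    Finset (Fin N × Fin F) :=
  Finset.univ.filter fun q => q.2 ∈ c.cachedBits k F

lemma card_add_card_le_union_fileSet {N F : ℕ} (Z : Finset (Fin N × Fin F)) (i : Fin N)
    (A : Finset (Fin F)) (hA : ∀ j ∈ A, (i, j) ∉ Z) :
    Z.card + A.card ≤ (Z ∪ fileSet F i).card := by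
  rw [← Finset.card_map ⟨Prod.mk i, Prod.mk_right_injective i⟩ (s := A),
    ← Finset.card_union_of_disjoint]
  · apply Finset.card_le_card
    apply Finset.union_subset_union_right
    intro q
    simp only [Finset.mem_map, Function.Embedding.coeFn_mk, fileSet, Finset.mem_filter,
      Finset.mem_univ, true_and]
    rintro ⟨j, -, rfl⟩
    rfl
  · rw [Finset.disjoint_right]
    intro q
    simp only [Finset.mem_map, Function.Embedding.coeFn_mk]
    rintro ⟨j, hj, rfl⟩
    exact hA j hj

lemma obs_fileBits_union {N F : ℕ} (Z : Finset (Fin N × Fin F)) (i : Fin N) :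
    obs (fileBits N F) (Z ∪ fileSet F i) =
      obs (fileBits N F) Z ⊓ Setoid.ker fun W => W i := by
  rw [obs_union]
  congr 1
  ext W V
  simp only [obs_iff, fileSet, Finset.mem_filter, Finset.mem_univ, true_and, Setoid.ker_def,
    fileBits]
  exact ⟨fun h => funext fun j => h (i, j) rfl, fun h q hq => by rw [hq, h]⟩

lemma ent_obs_fileBits {N F : ℕ} (S : Finset (Fin N × Fin F)) :
    ent (obs (fileBits N F) S) = S.card :=
  ent_obs_eq_card _ (fun W V h => funext fun i => funext fun j => congrFun h (i, j))
    (by simp [ZMod.card, ← pow_mul, mul_comm]) S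

variable {c : CachingStrategy K μ} {B N F n : ℕ} (C : Code c B N F n)

/-- All channel inputs, as one family. -/
def Code.inputBits (W : Fin N → Fin F → ZMod 2) (q : Fin n × Fin B) : ZMod 2 :=
  C.encode W q.1 q.2

/-- The error probability of user `k` for a fixed state sequence. -/
noncomputable def Code.errorGiven (d : Fin K → Fin N) (k : Fin K)
    (s : Fin n → Fin K → Fin (B + 1)) : ℝ :=
  ∑ W : Fin N → Fin F → ZMod 2, if C.estimate k W s ≠ W (d k) then
    (Fintype.card (Fin N → Fin F → ZMod 2) : ℝ)⁻¹ else 0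

lemma Code.errorProb_eq (P : PMF (Fin K → Fin (B + 1))) (d : Fin K → Fin N) (k : Fin K) :
    C.errorProb P d k = iidMean (fun a => (P a).toReal) (C.errorGiven d k) := by
  rw [errorProb, Finset.sum_comm]
  refine Finset.sum_congr rfl fun s _ => ?_
  rw [errorGiven, Finset.mul_sum]
  refine Finset.sum_congr rfl fun W _ => ?_
  split_ifs
  · ring
  · ring

lemma Code.obs_le_ker_estimate (k : Fin K) (s : Fin n → Fin K → Fin (B + 1))
    {Z : Finset (Fin N × Fin F)} (hZ : c.cacheSet k N F ⊆ Z) :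
    obs (fileBits N F) Z ⊓ obs C.inputBits (received s k) ≤
      Setoid.ker fun W => C.estimate k W s := by
  intro W V h
  rw [Setoid.inf_iff_and] at h
  have h1 : (fun t => channelOutput (s t k) (C.encode W t)) =
      fun t => channelOutput (s t k) (C.encode V t) := by
    funext t
    rw [channelOutput_eq_iff]
    intro i hi
    exact h.2 (t, i) (by simpa [received] using hi)
  have h2 : (fun (i : Fin N) (j : c.cachedBits k F) => W i j) =
      fun (i : Fin N) (j : c.cachedBits k F) => V i j := by
    funext i j
    exact h.1 (i, j) (hZ (by simp [CachingStrategy.cacheSet]))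
  rw [Setoid.ker_def]
  simp only [Code.estimate, h1, h2]

/-- Fano's inequality for user `k` with any side information `Z` containing its cache; the freedom
in `Z` accommodates the genie in `Code.second_user_le`. -/
lemma Code.ent_decode_le (d : Fin K → Fin N) (k : Fin K) (s : Fin n → Fin K → Fin (B + 1))
    {Z : Finset (Fin N × Fin F)} (hZ : c.cacheSet k N F ⊆ Z) :
    ent (obs (fileBits N F) (Z ∪ fileSet F (d k)) ⊓ obs C.inputBits (received s k)) ≤
      ent (obs (fileBits N F) Z ⊓ obs C.inputBits (received s k)) + 1 +
        F * C.errorGiven d k s := by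
  rw [obs_fileBits_union, inf_right_comm]
  have hA : Fintype.card (Fin F → ZMod 2) = 2 ^ F := by simp [ZMod.card]
  have h := ent_inf_ker_fano (obs (fileBits N F) Z ⊓ obs C.inputBits (received s k))
    (fun W => W (d k)) (fun W => C.estimate k W s) (C.obs_le_ker_estimate k s hZ) hA
  exact h

/-- The information about the channel inputs in `S` given the cache of user `k` and its file. -/
noncomputable def Code.residual (d : Fin K → Fin N) (k : Fin K) (S : Finset (Fin n × Fin B)) : ℝ :=
  ent (obs (fileBits N F) (c.cacheSet k N F ∪ fileSet F (d k)) ⊓ obs C.inputBits S) -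
    ent (obs (fileBits N F) (c.cacheSet k N F ∪ fileSet F (d k)))

/-- The cache together with the received bits has entropy at most the sum of the two counts. Up to
the Fano loss it also determines the requested file, at least `F (1 - μ)` bits of which are new; the
rest of the entropy is the residual. -/
lemma Code.first_user_le (d : Fin K → Fin N) (k : Fin K) (s : Fin n → Fin K → Fin (B + 1)) :
    F * (1 - μ) + C.residual d k (received s k) ≤
      (received s k).card + 1 + F * C.errorGiven d k s := by
  have h1 := C.ent_decode_le d k s (Finset.Subset.refl _)
  have h2 := ent_inf_obs_le C.inputBits (obs (fileBits N F) (c.cacheSet k N F)) (received s k)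
  have h3 := c.le_card_uncached k F
  have h4 : (((c.cacheSet k N F).card + (c.uncached k F).card : ℕ) : ℝ) ≤
      (c.cacheSet k N F ∪ fileSet F (d k)).card := by
    exact_mod_cast card_add_card_le_union_fileSet _ (d k) _ fun j hj => by
      simpa [CachingStrategy.cacheSet] using CachingStrategy.mem_uncached.1 hj
  rw [ent_obs_fileBits] at h2
  rw [residual, ent_obs_fileBits]
  push_cast at h4
  linarith

/-- A genie gives `k'` the cache and file of `k`. As the requests differ, bits of the file of `k'`
that neither user caches are still unknown and must come from the channel. Dropping the cache of
`k'` from the conditioning can only enlarge the entropy of its output. -/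
lemma Code.second_user_le {d : Fin K → Fin N} (hd : Function.Injective d) {k k' : Fin K}
    (hk : k ≠ k') (s : Fin n → Fin K → Fin (B + 1)) :
    F * (1 - 2 * μ) ≤ C.residual d k (received s k') + 1 + F * C.errorGiven d k' s := by
  set V := c.cacheSet k N F ∪ fileSet F (d k) with hV
  set V' := V ∪ c.cacheSet k' N F with hV'
  have h1 := C.ent_decode_le d k' s (Z := V') Finset.subset_union_right
  have h2 : ent (obs (fileBits N F) (V' ∪ fileSet F (d k'))) ≤
      ent (obs (fileBits N F) (V' ∪ fileSet F (d k')) ⊓ obs C.inputBits (received s k')) :=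
    ent_anti inf_le_left
  have h3 := ent_inf_sub_le (obs C.inputBits (received s k'))
    (obs_anti (fileBits N F) (Finset.subset_union_left : V ⊆ V'))
  have h4 : ((V'.card + (c.uncached k F ∩ c.uncached k' F).card : ℕ) : ℝ) ≤
      (V' ∪ fileSet F (d k')).card := by
    exact_mod_cast card_add_card_le_union_fileSet _ (d k') _ fun j hj => by
      rw [Finset.mem_inter, CachingStrategy.mem_uncached, CachingStrategy.mem_uncached] at hj
      simp [hV', hV, CachingStrategy.cacheSet, fileSet, hj.1, hj.2, hd.eq_iff, hk.symm]
  have h5 := c.le_card_uncached_inter k k' F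
  rw [ent_obs_fileBits] at h2 h3
  push_cast at h4
  rw [residual]
  linarith

/-- This and the next three lemmas are the polymatroid hypotheses of `iidMean_received_sub_le`. -/
lemma Code.residual_empty (d : Fin K → Fin N) (k : Fin K) : C.residual d k ∅ = 0 := by
  rw [residual, obs_empty, inf_top_eq, sub_self]

lemma Code.residual_mono (d : Fin K → Fin N) (k : Fin K) : Monotone (C.residual d k) :=
  fun _ _ h => sub_le_sub_right (ent_anti (inf_le_inf_left _ (obs_anti _ h))) _

lemma Code.residual_insert_le (d : Fin K → Fin N) (k : Fin K) (q : Fin n × Fin B)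
    (S : Finset (Fin n × Fin B)) : C.residual d k (insert q S) ≤ C.residual d k S + 1 := by
  have := ent_inf_obs_insert_le C.inputBits
    (obs (fileBits N F) (c.cacheSet k N F ∪ fileSet F (d k))) q S
  rw [residual, residual]
  linarith

lemma Code.residual_union_sub_le (d : Fin K → Fin N) (k : Fin K)
    (S T A : Finset (Fin n × Fin B)) (h : S ⊆ T) :
    C.residual d k (T ∪ A) - C.residual d k T ≤ C.residual d k (S ∪ A) - C.residual d k S := by
  have := ent_inf_sub_le (obs C.inputBits A) (inf_le_inf_left
    (obs (fileBits N F) (c.cacheSet k N F ∪ fileSet F (d k))) (obs_anti C.inputBits h))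
  simp only [residual, obs_union C.inputBits, ← inf_assoc]
  linarith

variable (P : PMF (Fin K → Fin (B + 1)))

lemma Code.single_user_bound (d : Fin K → Fin N) (k : Fin K) :
    F * (1 - μ) ≤ n * ∑ i : Fin B, ccdf P k (i + 1) + 1 + F * C.errorProb P d k := by
  have hp0 : ∀ a, 0 ≤ (P a).toReal := fun a => ENNReal.toReal_nonneg
  have h : ∀ s : Fin n → Fin K → Fin (B + 1), F * (1 - μ) ≤
      ((received s k).card : ℝ) + 1 + F * C.errorGiven d k s := by
    intro s
    have h1 := C.first_user_le d k s
    have h2 := C.residual_mono d k (Finset.empty_subset (received s k))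
    rw [C.residual_empty] at h2
    linarith
  have h2 := iidMean_mono hp0 h
  rw [iidMean_const (sum_pmf P), iidMean_add, iidMean_add, iidMean_const (sum_pmf P),
    iidMean_const_mul, mean_card_received, ← C.errorProb_eq] at h2
  exact h2

/-- Add `ω` times the bound at `k`, the bound at `k'` and the extremal inequality: the residual
entropies cancel, and so does `ω` times the mean number of slots received by `k`. -/
lemma Code.two_user_bound {d : Fin K → Fin N} (hd : Function.Injective d) {k k' : Fin K}
    (hk : k ≠ k') {ω : ℝ} (hω : 1 ≤ ω) :
    F * (ω * (1 - μ) + (1 - 2 * μ)) ≤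
      n * ∑ i : Fin B, max (ω * ccdf P k (i + 1)) (ccdf P k' (i + 1)) + (ω + 1) +
        F * (ω * C.errorProb P d k + C.errorProb P d k') := by
  have hp0 : ∀ a, 0 ≤ (P a).toReal := fun a => ENNReal.toReal_nonneg
  have h1 := iidMean_mono hp0 (C.first_user_le d k)
  have h2 := iidMean_mono hp0 (C.second_user_le hd hk)
  have h3 := iidMean_received_sub_le P (C.residual_mono d k) (C.residual_empty d k)
    (C.residual_insert_le d k) (C.residual_union_sub_le d k) k k' hω
  rw [iidMean_add, iidMean_const (sum_pmf P), iidMean_add, iidMean_add, iidMean_const (sum_pmf P),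
    iidMean_const_mul, mean_card_received, ← C.errorProb_eq] at h1
  rw [iidMean_const (sum_pmf P), iidMean_add, iidMean_add, iidMean_const (sum_pmf P),
    iidMean_const_mul, ← C.errorProb_eq] at h2
  rw [Finset.sum_sub_distrib, ← Finset.mul_sum] at h3
  nlinarith [mul_le_mul_of_nonneg_left h1 (by linarith : (0 : ℝ) ≤ ω)]

lemma Code.errorProb_nonneg (d : Fin K → Fin N) (k : Fin K) : 0 ≤ C.errorProb P d k := by
  rw [errorProb]
  refine Finset.sum_nonneg fun W _ => Finset.sum_nonneg fun s _ => ?_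
  split_ifs
  · exact mul_nonneg (by positivity) (Finset.prod_nonneg fun _ _ => ENNReal.toReal_nonneg)
  · exact le_rfl

/-- Passing to the limit in a bound for all block lengths. -/
lemma le_of_floor_mul_le {f A R b : ℝ} {e : ℕ → ℝ} (hf : 0 ≤ f) (he : Tendsto e atTop (𝓝 0))
    (h : ∀ n : ℕ, (⌊(n : ℝ) * f⌋₊ : ℝ) * A ≤ n * R + b + (⌊(n : ℝ) * f⌋₊ : ℝ) * e n) :
    f * A ≤ R := by
  have h1 : Tendsto (fun n : ℕ => (⌊(n : ℝ) * f⌋₊ : ℝ) / n) atTop (𝓝 f) := by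
    have := (tendsto_nat_floor_mul_div_atTop hf).comp (tendsto_natCast_atTop_atTop (R := ℝ))
    refine this.congr fun n => ?_
    simp [mul_comm]
  have h2 : Tendsto (fun n : ℕ => R + b / n + (⌊(n : ℝ) * f⌋₊ : ℝ) / n * e n) atTop
      (𝓝 (R + 0 + f * 0)) :=
    (tendsto_const_nhds.add (tendsto_const_div_atTop_nhds_zero_nat b)).add (h1.mul he)
  rw [mul_zero, add_zero, add_zero] at h2
  refine le_of_tendsto_of_tendsto (h1.mul_const A) h2 ?_
  filter_upwards [eventually_gt_atTop 0] with n hn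
  have hn' : (0 : ℝ) < n := by exact_mod_cast hn
  have := div_le_div_of_nonneg_right (h n) hn'.le
  refine le_trans (le_of_eq (by ring)) (this.trans (le_of_eq ?_))
  field_simp

variable {P} in
lemma Achievable.mul_one_sub_le {d : Fin K → Fin N} {f : ℝ} (h : Achievable P c d f) (k : Fin K) :
    f * (1 - μ) ≤ ∑ i : Fin B, ccdf P k (i + 1) := by
  obtain ⟨hf, C, hC⟩ := h
  have hk : Tendsto (fun n => (C n).errorProb P d k) atTop (𝓝 0) :=
    squeeze_zero (fun n => (C n).errorProb_nonneg P d k)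
      (fun n => Finset.single_le_sum (f := fun k => (C n).errorProb P d k)
        (fun j _ => (C n).errorProb_nonneg P d j) (Finset.mem_univ k)) hC
  exact le_of_floor_mul_le hf hk fun n => (C n).single_user_bound P d k

variable {P} in
lemma Achievable.weighted_le {d : Fin K → Fin N} (hd : Function.Injective d) {f : ℝ}
    (h : Achievable P c d f) {k k' : Fin K} (hk : k ≠ k') {ω : ℝ} (hω : 1 ≤ ω) :
    f * (ω * (1 - μ) + (1 - 2 * μ)) ≤
      ∑ i : Fin B, max (ω * ccdf P k (i + 1)) (ccdf P k' (i + 1)) := by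
  obtain ⟨hf, C, hC⟩ := h
  have herr : ∀ k, Tendsto (fun n => (C n).errorProb P d k) atTop (𝓝 0) := fun k =>
    squeeze_zero (fun n => (C n).errorProb_nonneg P d k)
      (fun n => Finset.single_le_sum (f := fun k => (C n).errorProb P d k)
        (fun j _ => (C n).errorProb_nonneg P d j) (Finset.mem_univ k)) hC
  have he := ((herr k).const_mul ω).add (herr k')
  rw [mul_zero, add_zero] at he
  exact le_of_floor_mul_le hf he fun n => (C n).two_user_bound P hd hk hω

end Converse

/-! ### The rate sums as sums of levelwise maxima -/

section RateSums

variable {B : ℕ} (P : PMF (Fin 2 → Fin (B + 1)))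

/-- The threshold rule defining `R₁` and `R₂` gives each level to the user with the larger weighted
ccdf. -/
lemma mul_R₁_add_R₂ (ω : ℝ) : ω * R₁ P ω + R₂ P ω =
    ∑ i : Fin B, max (ω * ccdf P 0 (i + 1)) (ccdf P 1 (i + 1)) := by
  rw [R₁, R₂, Finset.mul_sum, ← Finset.sum_add_distrib, sum_Icc_levels]
  refine Finset.sum_congr rfl fun i _ => ?_
  by_cases h : ccdf P 1 (i + 1) ≤ ω * ccdf P 0 (i + 1)
  · rw [if_pos h, if_neg (not_lt.2 h), max_eq_left h, add_zero]
  · rw [if_neg h, if_pos (not_le.1 h), max_eq_right (not_le.1 h).le, mul_zero, zero_add]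

lemma R₁_add_mul_R₂ {ω : ℝ} (hω : 0 < ω) : R₁ P ω + 1 / ω * R₂ P ω =
    ∑ i : Fin B, max (1 / ω * ccdf P 1 (i + 1)) (ccdf P 0 (i + 1)) := by
  have h : R₁ P ω + 1 / ω * R₂ P ω = 1 / ω * (ω * R₁ P ω + R₂ P ω) := by
    field_simp
  rw [h, mul_R₁_add_R₂, Finset.mul_sum]
  refine Finset.sum_congr rfl fun i _ => ?_
  rw [mul_max_of_nonneg _ _ (by positivity), max_comm]
  congr 1
  field_simp

end RateSums

/-- The second infimum is the two-user bound with the users exchanged and weight `1 / ω ≥ 1`. -/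
lemma Achievable.le_fStarSmall {B N : ℕ} {P : PMF (Fin 2 → Fin (B + 1))} {μ : ℝ} (h1 : μ ≤ 1 / 2)
    {d : Fin 2 → Fin N} (hd : Function.Injective d) {c : CachingStrategy 2 μ} {f : ℝ}
    (h : Achievable P c d f) : f ≤ fStarSmall P μ := by
  refine le_min (le_ciInf fun ω => ?_) ?_
  · have hω : (1 : ℝ) ≤ ω := ω.2
    rw [le_div_iff₀ (by nlinarith), mul_R₁_add_R₂]
    exact h.weighted_le hd (by decide) hω
  · have : Nonempty (Set.Ioc (0 : ℝ) 1) := ⟨⟨1, by norm_num⟩⟩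
    refine le_ciInf fun ω => ?_
    have hω0 : (0 : ℝ) < ω := ω.2.1
    have hω : 1 ≤ 1 / (ω : ℝ) := (one_le_div hω0).2 ω.2.2
    rw [le_div_iff₀ (by nlinarith), R₁_add_mul_R₂ P hω0, add_comm (1 - 2 * μ)]
    exact h.weighted_le hd (by decide) hω

lemma Achievable.le_fStarLarge {B N : ℕ} {P : PMF (Fin 2 → Fin (B + 1))} {μ : ℝ} (h1 : μ < 1)
    {d : Fin 2 → Fin N} {c : CachingStrategy 2 μ} {f : ℝ}
    (h : Achievable P c d f) : f ≤ fStarLarge P μ := by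
  refine le_min ?_ ?_ <;> rw [le_div_iff₀ (by linarith), sum_Icc_levels] <;>
    exact h.mul_one_sub_le _

/-! ### Linear programming for the allocation of levels -/

section LevelAllocation

/-- The levelwise inequality behind `weighted_rates_le`: two allocations between the users' private
uses are charged to the best single use of the level among the three streams. -/
lemma max_add_max_le {x y α β γ₁ γ₂ M : ℝ} (hx : 0 ≤ x) (hy : 0 ≤ y) (hγ₁ : 0 ≤ γ₁) (hγ₂ : 0 ≤ γ₂)
    (hα : α ≤ γ₁ + γ₂) (hβ : β ≤ γ₁ + γ₂) (h1 : α * x ≤ M) (h2 : β * y ≤ M)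
    (h3 : γ₁ * x + γ₂ * y ≤ M) :
    max (γ₁ * x) (max (β - γ₂) 0 * y) + max (max (α - γ₁) 0 * x) (γ₂ * y) ≤ M := by
  have hγx := mul_nonneg hγ₁ hx
  have hγy := mul_nonneg hγ₂ hy
  have hb : max (β - γ₂) 0 * y + γ₂ * y ≤ M := by
    rcases max_cases (β - γ₂) 0 with ⟨h, _⟩ | ⟨h, _⟩ <;> rw [h] <;> nlinarith
  have ha : γ₁ * x + max (α - γ₁) 0 * x ≤ M := by
    rcases max_cases (α - γ₁) 0 with ⟨h, _⟩ | ⟨h, _⟩ <;> rw [h] <;> nlinarith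
  have hbγ : max (β - γ₂) 0 ≤ γ₁ := max_le (by linarith) hγ₁
  have haγ : max (α - γ₁) 0 ≤ γ₂ := max_le (by linarith) hγ₂
  have hb0 := le_max_right (β - γ₂) 0
  have ha0 := le_max_right (α - γ₁) 0
  generalize max (β - γ₂) 0 = b at *
  generalize max (α - γ₁) 0 = a at *
  rcases max_cases (γ₁ * x) (b * y) with ⟨h, h'⟩ | ⟨h, h'⟩ <;>
    rcases max_cases (a * x) (γ₂ * y) with ⟨g, g'⟩ | ⟨g, g'⟩ <;> rw [h, g]
  · exact ha
  · exact h3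
  -- The crossed choice is degenerate: unless `a` or `b` vanishes, the two comparisons force `x =
  -- y`.
  · rcases hb0.eq_or_lt with rfl | hb0
    · linarith
    rcases ha0.eq_or_lt with rfl | ha0
    · linarith
    have hxy : x ≤ y := by
      have : γ₁ * x ≤ γ₁ * y := h'.le.trans (mul_le_mul_of_nonneg_right hbγ hy)
      exact le_of_mul_le_mul_left this (hb0.trans_le hbγ)
    have hyx : y ≤ x := by
      have : γ₂ * y ≤ γ₂ * x := g'.trans (mul_le_mul_of_nonneg_right haγ hx)
      exact le_of_mul_le_mul_left this (ha0.trans_le haγ)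
    have := le_antisymm hxy hyx
    subst this
    nlinarith
  · exact hb

variable {ι : Type*}

/-- The rates delivered when the fraction `θ i j` of level `i` is used for stream `j`: stream `0` is
received by the first user, stream `1` by the second user and stream `2` by both. -/
def allocRate [Fintype ι] (F₁ F₂ : ι → ℝ) (θ : ι → Fin 3 → ℝ) : Fin 4 → ℝ :=
  ![∑ i, θ i 0 * F₁ i, ∑ i, θ i 1 * F₂ i, ∑ i, θ i 2 * F₁ i, ∑ i, θ i 2 * F₂ i]

/-- The allocations of levels to the three streams. -/
def IsAllocation (θ : ι → Fin 3 → ℝ) : Prop := (∀ i j, 0 ≤ θ i j) ∧ ∀ i, ∑ j, θ i j = 1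

lemma allocRate_combo [Fintype ι] (F₁ F₂ : ι → ℝ) (θ η : ι → Fin 3 → ℝ) (a b : ℝ) :
    allocRate F₁ F₂ (a • θ + b • η) = a • allocRate F₁ F₂ θ + b • allocRate F₁ F₂ η := by
  funext j
  fin_cases j <;>
    simp [allocRate, add_mul, Finset.sum_add_distrib, Finset.mul_sum, mul_assoc]

lemma IsAllocation.combo {θ η : ι → Fin 3 → ℝ} (hθ : IsAllocation θ) (hη : IsAllocation η)
    {a b : ℝ} (ha : 0 ≤ a) (hb : 0 ≤ b) (hab : a + b = 1) : IsAllocation (a • θ + b • η) := by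
  refine ⟨fun i j => ?_, fun i => ?_⟩
  · have := mul_nonneg ha (hθ.1 i j)
    have := mul_nonneg hb (hη.1 i j)
    simp only [Pi.add_apply, Pi.smul_apply, smul_eq_mul]
    linarith
  · simp only [Pi.add_apply, Pi.smul_apply, smul_eq_mul, Finset.sum_add_distrib, ← Finset.mul_sum,
      hθ.2, hη.2]
    linarith

variable [Fintype ι]

/-- For every weight vector there is a best allocation, which works level by level. -/
lemma exists_allocation_max (F₁ F₂ : ι → ℝ) (w : Fin 4 → ℝ) :
    ∃ θ : ι → Fin 3 → ℝ, IsAllocation θ ∧ ∑ j, w j * allocRate F₁ F₂ θ j =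
      ∑ i, max (w 0 * F₁ i) (max (w 1 * F₂ i) (w 2 * F₁ i + w 3 * F₂ i)) := by
  have h : ∀ i, ∃ e : Fin 3 → ℝ, ((∀ j, 0 ≤ e j) ∧ ∑ j, e j = 1) ∧
      e 0 * (w 0 * F₁ i) + e 1 * (w 1 * F₂ i) + e 2 * (w 2 * F₁ i + w 3 * F₂ i) =
        max (w 0 * F₁ i) (max (w 1 * F₂ i) (w 2 * F₁ i + w 3 * F₂ i)) := by
    intro i
    rcases max_choice (w 0 * F₁ i) (max (w 1 * F₂ i) (w 2 * F₁ i + w 3 * F₂ i)) with h1 | h1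
    · refine ⟨![1, 0, 0], ⟨fun j => by fin_cases j <;> simp, by simp [Fin.sum_univ_succ]⟩, ?_⟩
      rw [h1]
      simp
    · rcases max_choice (w 1 * F₂ i) (w 2 * F₁ i + w 3 * F₂ i) with h2 | h2
      · refine ⟨![0, 1, 0], ⟨fun j => by fin_cases j <;> simp, by simp [Fin.sum_univ_succ]⟩, ?_⟩
        rw [h1, h2]
        simp
      · refine ⟨![0, 0, 1], ⟨fun j => by fin_cases j <;> simp, by simp [Fin.sum_univ_succ]⟩, ?_⟩
        rw [h1, h2]
        simp
  choose e he1 he2 using h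
  refine ⟨e, ⟨fun i => (he1 i).1, fun i => (he1 i).2⟩, ?_⟩
  rw [← Finset.sum_congr rfl fun i _ => he2 i]
  simp only [allocRate, Fin.sum_univ_four, Matrix.cons_val, Finset.mul_sum,
    ← Finset.sum_add_distrib]
  exact Finset.sum_congr rfl fun i _ => by ring

/-- Linear programming duality for level allocations. -/
lemma exists_allocation_of_forall_weights (F₁ F₂ : ι → ℝ) (T : Fin 4 → ℝ)
    (hT : ∀ w : Fin 4 → ℝ, (∀ j, 0 ≤ w j) → ∑ j, w j * T j ≤
      ∑ i, max (w 0 * F₁ i) (max (w 1 * F₂ i) (w 2 * F₁ i + w 3 * F₂ i))) {δ : ℝ} (hδ : 0 < δ) :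
    ∃ θ : ι → Fin 3 → ℝ, IsAllocation θ ∧ ∀ j, T j - δ < allocRate F₁ F₂ θ j := by
  -- The rate vectors strictly dominated by an allocation form an open convex down-set. The slack
  -- `δ` makes this open set enough, with no closedness argument.
  set C : Set (Fin 4 → ℝ) := {v | ∃ θ, IsAllocation θ ∧ ∀ j, v j < allocRate F₁ F₂ θ j} with hC
  by_contra hcon
  have hnot : (fun j => T j - δ) ∉ C := fun ⟨θ, h1, h2⟩ => hcon ⟨θ, h1, h2⟩
  have hopen : IsOpen C := by
    have : C = ⋃ θ ∈ {θ | IsAllocation θ}, ⋂ j, {v | v j < allocRate F₁ F₂ θ j} := by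
      ext v
      simp [hC]
    rw [this]
    exact isOpen_biUnion fun θ _ => isOpen_iInter_of_finite fun j =>
      isOpen_lt (continuous_apply j) continuous_const
  have hconv : Convex ℝ C := by
    rintro u ⟨θ, hθ, hu⟩ v ⟨η, hη, hv⟩ a b ha hb hab
    refine ⟨a • θ + b • η, hθ.combo hη ha hb hab, fun j => ?_⟩
    rw [allocRate_combo]
    simp only [Pi.add_apply, Pi.smul_apply, smul_eq_mul]
    rcases ha.eq_or_lt with rfl | ha'
    · have : b = 1 := by linarith
      subst this
      linarith [hv j]
    · have h1 := mul_lt_mul_of_pos_left (hu j) ha'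
      have h2 := mul_le_mul_of_nonneg_left (hv j).le hb
      linarith
  obtain ⟨f, hf⟩ := geometric_hahn_banach_open_point hconv hopen hnot
  set w : Fin 4 → ℝ := fun j => f (Pi.single j 1) with hw
  have hfw : ∀ v, f v = ∑ j, w j * v j := by
    intro v
    conv_lhs => rw [← Finset.univ_sum_single v]
    rw [map_sum]
    refine Finset.sum_congr rfl fun j _ => ?_
    rw [show Pi.single j (v j) = v j • (Pi.single j 1 : Fin 4 → ℝ) by
      rw [← Pi.single_smul, smul_eq_mul, mul_one], map_smul, smul_eq_mul, mul_comm]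
  have hmem : ∀ θ, IsAllocation θ → ∀ (u : Fin 4 → ℝ), (∀ j, 0 ≤ u j) → ∀ ε : ℝ, 0 < ε →
      (fun j => allocRate F₁ F₂ θ j - ε - u j) ∈ C := fun θ hθ u hu ε hε =>
    ⟨θ, hθ, fun j => by linarith [hu j]⟩
  obtain ⟨θ, hθ, -⟩ := exists_allocation_max F₁ F₂ w
  have hw0 : ∀ j, 0 ≤ w j := by
    intro j
    by_contra hneg
    push Not at hneg
    -- `C` is closed downwards, so lowering coordinate `j` stays in `C` but raises `f` if `w j < 0`;
    -- this `M` is enough to overtake the separated point.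
    set M := |f (fun j => allocRate F₁ F₂ θ j - 1) - f fun j => T j - δ| / -(w j) with hM
    have hM0 : 0 ≤ M := div_nonneg (abs_nonneg _) (by linarith)
    have h1 := hf _ (hmem θ hθ (Pi.single j M) (fun i => by
      by_cases h : i = j
      · subst h; simpa using hM0
      · simp [h]) 1 one_pos)
    have h2 : (fun i => allocRate F₁ F₂ θ i - 1 - (Pi.single j M : Fin 4 → ℝ) i) =
        (fun i => allocRate F₁ F₂ θ i - 1) - M • (Pi.single j 1 : Fin 4 → ℝ) := by
      rw [← Pi.single_smul, smul_eq_mul, mul_one]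
      rfl
    rw [h2, map_sub, map_smul, smul_eq_mul] at h1
    change _ - M * w j < _ at h1
    have h3 : M * w j = -|f (fun j => allocRate F₁ F₂ θ j - 1) - f fun j => T j - δ| := by
      rw [hM, div_neg, neg_mul, div_mul_cancel₀ _ hneg.ne]
    have h4 := neg_abs_le (f (fun j => allocRate F₁ F₂ θ j - 1) - f fun j => T j - δ)
    linarith
  obtain ⟨η, hη, hmax⟩ := exists_allocation_max F₁ F₂ w
  have hle : ∑ j, w j * allocRate F₁ F₂ η j ≤ ∑ j, w j * (T j - δ) := by
    refine le_of_forall_pos_le_add fun ε hε => ?_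
    have hs : 0 ≤ ∑ j, w j := Finset.sum_nonneg fun j _ => hw0 j
    have h1 := hf _ (hmem η hη 0 (fun _ => le_rfl) (ε / (1 + ∑ j, w j)) (by positivity))
    rw [hfw, hfw] at h1
    simp only [Pi.zero_apply, sub_zero, mul_sub, Finset.sum_sub_distrib, ← Finset.sum_mul] at h1 ⊢
    have h2 : (∑ j, w j) * (ε / (1 + ∑ j, w j)) ≤ ε := by
      rw [mul_div_assoc', div_le_iff₀ (by positivity)]
      nlinarith
    linarith
  have h1 := hT w hw0
  rw [← hmax] at h1
  simp only [mul_sub, Finset.sum_sub_distrib, ← Finset.sum_mul] at hle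
  -- The hypothesis gives `w · T ≤ w · T - δ ∑ w`, so all weights vanish, contradicting strict
  -- separation.
  have hs : ∑ j, w j ≤ 0 := by
    by_contra hpos
    push Not at hpos
    nlinarith
  have hz : ∀ j, w j = 0 := fun j =>
    le_antisymm ((Finset.single_le_sum (fun i _ => hw0 i) (Finset.mem_univ j)).trans hs) (hw0 j)
  have h2 := hf _ (hmem θ hθ 0 (fun _ => le_rfl) 1 one_pos)
  rw [hfw, hfw] at h2
  simp [hz] at h2

variable {F₁ F₂ : ι → ℝ}

/-- The two families of two-user bounds imply the bounds for all weights. -/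
lemma weighted_rates_le (hF₁ : ∀ i, 0 ≤ F₁ i) (hF₂ : ∀ i, 0 ≤ F₂ i) {r₀ r₁ r₂ : ℝ} (h0 : 0 ≤ r₀)
    (h1 : 0 ≤ r₁) (h2 : 0 ≤ r₂)
    (hfst : ∀ a b : ℝ, 0 ≤ b → b ≤ a → a * (r₀ + r₁) + b * r₂ ≤ ∑ i, max (a * F₁ i) (b * F₂ i))
    (hsnd : ∀ a b : ℝ, 0 ≤ a → a ≤ b → a * r₁ + b * (r₀ + r₂) ≤ ∑ i, max (a * F₁ i) (b * F₂ i))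
    {α β γ₁ γ₂ : ℝ} (hα : 0 ≤ α) (hβ : 0 ≤ β) (hγ₁ : 0 ≤ γ₁) (hγ₂ : 0 ≤ γ₂) :
    α * r₁ + β * r₂ + (γ₁ + γ₂) * r₀ ≤
      ∑ i, max (α * F₁ i) (max (β * F₂ i) (γ₁ * F₁ i + γ₂ * F₂ i)) := by
  have hmax : ∑ i, max (α * F₁ i) (β * F₂ i) ≤
      ∑ i, max (α * F₁ i) (max (β * F₂ i) (γ₁ * F₁ i + γ₂ * F₂ i)) :=
    Finset.sum_le_sum fun i _ => max_le_max le_rfl (le_max_left _ _)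
  by_cases hA : γ₁ + γ₂ ≤ α ∧ β ≤ α
  · have := hfst α β hβ hA.2
    nlinarith [mul_le_mul_of_nonneg_right hA.1 h0]
  by_cases hB : γ₁ + γ₂ ≤ β ∧ α ≤ β
  · have := hsnd α β hα hB.2
    nlinarith [mul_le_mul_of_nonneg_right hB.1 h0]
  have hγα : α ≤ γ₁ + γ₂ := by
    by_contra h
    push Not at h
    exact hB ⟨by by_contra h'; push Not at h'; exact hA ⟨h.le, (h'.trans h).le⟩,
      by by_contra h'; push Not at h'; exact hA ⟨h.le, h'.le⟩⟩
  have hγβ : β ≤ γ₁ + γ₂ := by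
    by_contra h
    push Not at h
    exact hB ⟨h.le, hγα.trans h.le⟩
  -- When the common weight `γ₁ + γ₂` dominates `α` and `β`, split it over two bounds, `hfst` at
  -- `(γ₁, b)` and `hsnd` at `(a, γ₂)`; `a` and `b` are the smallest nonnegative amounts by which
  -- `γ₁` and `γ₂` must be topped up to reach `α` and `β`.
  set b := max (β - γ₂) 0 with hb
  set a := max (α - γ₁) 0 with ha
  have e1 := hfst γ₁ b (le_max_right _ _) (max_le (by linarith) hγ₁)
  have e2 := hsnd a γ₂ (le_max_right _ _) (max_le (by linarith) hγ₂)
  have hab : α ≤ γ₁ + a := by linarith [le_max_left (α - γ₁) 0]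
  have hbb : β ≤ γ₂ + b := by linarith [le_max_left (β - γ₂) 0]
  have e3 : ∑ i, max (γ₁ * F₁ i) (b * F₂ i) + ∑ i, max (a * F₁ i) (γ₂ * F₂ i) ≤
      ∑ i, max (α * F₁ i) (max (β * F₂ i) (γ₁ * F₁ i + γ₂ * F₂ i)) := by
    rw [← Finset.sum_add_distrib]
    refine Finset.sum_le_sum fun i _ => ?_
    have x0 := hF₁ i
    have y0 := hF₂ i
    generalize F₁ i = x at x0
    generalize F₂ i = y at y0
    have m1 := le_max_left (α * x) (max (β * y) (γ₁ * x + γ₂ * y))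
    have m2 := (le_max_left (β * y) (γ₁ * x + γ₂ * y)).trans (le_max_right (α * x) _)
    have m3 := (le_max_right (β * y) (γ₁ * x + γ₂ * y)).trans (le_max_right (α * x) _)
    generalize max (α * x) (max (β * y) (γ₁ * x + γ₂ * y)) = M at m1 m2 m3
    exact max_add_max_le x0 y0 hγ₁ hγ₂ hγα hγβ m1 m2 m3
  nlinarith [mul_le_mul_of_nonneg_right hab h1, mul_le_mul_of_nonneg_right hbb h2]

end LevelAllocation

/-! ### Random coding -/

section RandomCodes

variable {M T : Type*} [Fintype M] [DecidableEq M] [Fintype T] [DecidableEq T]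

/-- Two codewords of a uniformly random code agree on `S` with probability at most `2 ^ (-|S|)`. -/
lemma card_agree_mul_le {m m' : M} (hm : m ≠ m') (S : Finset T) :
    (Finset.univ.filter fun c : M → T → ZMod 2 => ∀ t ∈ S, c m t = c m' t).card * 2 ^ S.card ≤
      Fintype.card (M → T → ZMod 2) := by
  classical
  have h2 : Fintype.card (S → ZMod 2) = 2 ^ S.card := by simp [ZMod.card]
  rw [← h2, ← Finset.card_univ (α := S → ZMod 2), ← Finset.card_product, ← Finset.card_univ]
  -- Add an arbitrary pattern on `S` to codeword `m`. Nothing is lost: codeword `m'` is untouched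
  -- and still shows what `m` was on `S`.
  refine Finset.card_le_card_of_injOn (fun q : (M → T → ZMod 2) × (S → ZMod 2) =>
    Function.update q.1 m fun t => if h : t ∈ S then q.1 m t + q.2 ⟨t, h⟩ else q.1 m t)
    (fun _ _ => Finset.mem_coe.2 (Finset.mem_univ _)) ?_
  rintro ⟨c, a⟩ hc ⟨c', a'⟩ hc' h
  simp only [Finset.coe_product, Finset.coe_filter, Finset.mem_univ, true_and, Finset.coe_univ,
    Set.mem_prod, Set.mem_ofPred_eq, Set.mem_univ, and_true] at hc hc'
  have hne : ∀ u, u ≠ m → c u = c' u := by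
    intro u hu
    have := congrFun h u
    simpa only [Function.update_of_ne hu] using this
  have hm' := congrFun h m
  simp only [Function.update_self] at hm'
  have hcm : c m = c' m := by
    funext t
    by_cases ht : t ∈ S
    · rw [hc t ht, hc' t ht, hne m' hm.symm]
    · have := congrFun hm' t
      simpa only [ht, dif_neg, not_false_iff] using this
  have hcc : c = c' := by
    funext u
    by_cases hu : u = m
    · rw [hu, hcm]
    · exact hne u hu
  subst hcc
  refine Prod.ext rfl (funext fun t => ?_)
  have := congrFun hm' t
  simpa using this

open scoped Classical in
/-- Random coding: some code is at most as bad as a random one, where `x` is a transmission of the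
message `w x` received in the slots `S x`. -/
lemma exists_code_collision_le {X : Type*} [Fintype X] (w : X → M) (S : X → Finset T)
    {p : X → ℝ} (hp : ∀ x, 0 ≤ p x) :
    ∃ c : M → T → ZMod 2,
      ∑ x, p x * (if ∃ m, m ≠ w x ∧ ∀ t ∈ S x, c m t = c (w x) t then 1 else 0) ≤
        ∑ x, p x * min 1 ((Fintype.card M : ℝ) / 2 ^ (S x).card) := by
  have hcount : ∀ x, ∑ c : M → T → ZMod 2,
      (if ∃ m, m ≠ w x ∧ ∀ t ∈ S x, c m t = c (w x) t then (1 : ℝ) else 0) ≤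
      Fintype.card (M → T → ZMod 2) * min 1 ((Fintype.card M : ℝ) / 2 ^ (S x).card) := by
    intro x
    rw [mul_min_of_nonneg _ _ (by positivity), mul_one]
    refine le_min ?_ ?_
    · refine (Finset.sum_le_sum fun c _ => ?_).trans_eq
        ((Finset.sum_const (1 : ℝ)).trans (by simp))
      split_ifs <;> norm_num
    · have hpt : ∀ c : M → T → ZMod 2,
          (if ∃ m, m ≠ w x ∧ ∀ t ∈ S x, c m t = c (w x) t then (1 : ℝ) else 0) ≤
          ∑ m ∈ Finset.univ.erase (w x), if ∀ t ∈ S x, c m t = c (w x) t then (1 : ℝ) else 0 := by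
        intro c
        split_ifs with h
        · obtain ⟨m, hm, hcm⟩ := h
          refine le_trans ?_ (Finset.single_le_sum
            (f := fun m => if ∀ t ∈ S x, c m t = c (w x) t then (1 : ℝ) else 0)
            (fun _ _ => by split_ifs <;> norm_num)
            (Finset.mem_erase.2 ⟨hm, Finset.mem_univ _⟩))
          rw [if_pos hcm]
        · exact Finset.sum_nonneg fun _ _ => by split_ifs <;> norm_num
      refine (Finset.sum_le_sum fun c _ => hpt c).trans ?_
      rw [Finset.sum_comm]
      have hm : ∀ m ∈ Finset.univ.erase (w x), ∑ c : M → T → ZMod 2,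
          (if ∀ t ∈ S x, c m t = c (w x) t then (1 : ℝ) else 0) ≤
          Fintype.card (M → T → ZMod 2) / 2 ^ (S x).card := by
        intro m hm
        rw [Finset.sum_boole, le_div_iff₀ (by positivity)]
        exact_mod_cast card_agree_mul_le (Finset.ne_of_mem_erase hm) (S x)
      refine (Finset.sum_le_card_nsmul _ _ _ hm).trans ?_
      rw [nsmul_eq_mul, mul_div_assoc', mul_div_assoc', mul_comm (Fintype.card (M → T → ZMod 2) : ℝ)]
      have : ((Finset.univ.erase (w x)).card : ℝ) ≤ Fintype.card M := by
        exact_mod_cast Finset.card_le_univ _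
      gcongr
  -- The average over all codes obeys the union bound, so some code does.
  obtain ⟨c, -, hc⟩ := Finset.exists_le_of_sum_le
    (s := (Finset.univ : Finset (M → T → ZMod 2)))
    (f := fun c : M → T → ZMod 2 => ∑ x, p x * (if ∃ m, m ≠ w x ∧ ∀ t ∈ S x, c m t = c (w x) t then (1 : ℝ) else 0))
    (g := fun _ => ∑ x, p x * min 1 ((Fintype.card M : ℝ) / 2 ^ (S x).card)) ⟨fun _ _ => 0, Finset.mem_univ _⟩
    (by
      rw [Finset.sum_comm, Finset.sum_const, Finset.card_univ, nsmul_eq_mul, Finset.mul_sum]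
      refine Finset.sum_le_sum fun x _ => ?_
      rw [← Finset.mul_sum, mul_left_comm]
      exact mul_le_mul_of_nonneg_left (hcount x) (hp x))
  exact ⟨c, hc⟩

end RandomCodes

/-! ### Time sharing and collision probability of a stream -/

section Streams

variable {K B n : ℕ}

lemma sub_le_card_filter_fin {a b : ℕ} (hb : b ≤ n) :
    (b : ℝ) - a ≤ (Finset.univ.filter fun t : Fin n => a ≤ (t : ℕ) ∧ (t : ℕ) < b).card := by
  have h : (Finset.Ico a b) ⊆
      (Finset.univ.filter fun t : Fin n => a ≤ (t : ℕ) ∧ (t : ℕ) < b).map Fin.valEmbedding := by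
    intro t ht
    rw [Finset.mem_Ico] at ht
    simp only [Finset.mem_map, Finset.mem_filter, Finset.mem_univ, true_and, Fin.valEmbedding_apply]
    exact ⟨⟨t, by omega⟩, ht, rfl⟩
  have h2 := Finset.card_le_card h
  rw [Nat.card_Ico, Finset.card_map] at h2
  have h3 : b ≤ (Finset.univ.filter fun t : Fin n => a ≤ (t : ℕ) ∧ (t : ℕ) < b).card + a := by omega
  have h4 : (b : ℝ) ≤ (Finset.univ.filter fun t : Fin n => a ≤ (t : ℕ) ∧ (t : ℕ) < b).card + a := by
    exact_mod_cast h3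
  linarith

/-- Time sharing: the slots can be assigned to the streams in the given proportions. -/
lemma exists_slot_assignment {θ : Fin B → Fin 3 → ℝ} (hθ : IsAllocation θ) :
    ∃ τ : Fin n × Fin B → Fin 3, ∀ i j,
      n * θ i j - 1 ≤ (Finset.univ.filter fun t : Fin n => τ (t, i) = j).card := by
  -- On each level the channel uses are cut at the rounded-up cumulative fractions; rounding costs a
  -- stream at most one slot per level.
  refine ⟨fun q => if (q.1 : ℕ) < ⌈n * θ q.2 0⌉₊ then 0 else
    if (q.1 : ℕ) < ⌈n * (θ q.2 0 + θ q.2 1)⌉₊ then 1 else 2, fun i j => ?_⟩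
  have h0 := hθ.1 i 0
  have h1 := hθ.1 i 1
  have h2 := hθ.1 i 2
  have hs := hθ.2 i
  rw [Fin.sum_univ_three] at hs
  have hn : (0 : ℝ) ≤ n := Nat.cast_nonneg n
  have n0 := mul_nonneg hn h0
  have n1 := mul_nonneg hn h1
  have n2 := mul_nonneg hn h2
  have hadd : (n : ℝ) * (θ i 0 + θ i 1) = n * θ i 0 + n * θ i 1 := mul_add _ _ _
  have hsum : (n : ℝ) * θ i 0 + n * θ i 1 + n * θ i 2 = n := by
    rw [← mul_add, ← mul_add, hs, mul_one]
  set a := ⌈n * θ i 0⌉₊ with ha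
  set b := ⌈n * (θ i 0 + θ i 1)⌉₊ with hb
  have hab : a ≤ b := Nat.ceil_mono (by linarith)
  have hbn : b ≤ n := Nat.ceil_le.2 (by linarith)
  have a1 := Nat.le_ceil (n * θ i 0)
  have a2 := Nat.ceil_lt_add_one n0
  have b1 := Nat.le_ceil (n * (θ i 0 + θ i 1))
  have b2 := Nat.ceil_lt_add_one (a := n * (θ i 0 + θ i 1)) (by linarith)
  rw [← ha] at a1 a2
  rw [← hb] at b1 b2
  fin_cases j
  · refine le_trans ?_ ((sub_le_card_filter_fin (n := n) (a := 0) (hab.trans hbn)).trans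
      (Nat.cast_le.2 (Finset.card_le_card (Finset.monotone_filter_right _ fun t _ ht => ?_))))
    · simp
      linarith
    · exact if_pos ht.2
  · refine le_trans ?_ ((sub_le_card_filter_fin (n := n) (a := a) hbn).trans
      (Nat.cast_le.2 (Finset.card_le_card (Finset.monotone_filter_right _ fun t _ ht => ?_))))
    · simp
      linarith
    · exact (if_neg (not_lt.2 ht.1)).trans (if_pos ht.2)
  · refine le_trans ?_ ((sub_le_card_filter_fin (n := n) (a := b) le_rfl).trans
      (Nat.cast_le.2 (Finset.card_le_card (Finset.monotone_filter_right _ fun t _ ht => ?_))))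
    · simp
      linarith
    · exact (if_neg (not_lt.2 (hab.trans ht.1))).trans (if_neg (not_lt.2 ht.1))

/-- The slots of stream `j` that user `k` receives. -/
def streamReceived (τ : Fin n × Fin B → Fin 3) (j : Fin 3) (s : Fin n → Fin K → Fin (B + 1))
    (k : Fin K) : Finset (Fin n × Fin B) :=
  (received s k).filter fun q => τ q = j

variable (P : PMF (Fin K → Fin (B + 1)))

/-- Cut at `(ρ + δ) n` received slots. Fewer are unlikely by Chebyshev, since the mean is `δ n`
higher; with at least that many, the union bound is at most `2 ^ (-(δ n))`. -/
lemma iidMean_collision_le (τ : Fin n × Fin B → Fin 3) (j : Fin 3) (k : Fin K) {m : ℕ} {ρ δ : ℝ}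
    (hδ : 0 < δ) (hn : 0 < n) (hm : m ≤ n * ρ)
    (hmean : (ρ + 2 * δ) * n ≤ ∑ i : Fin B, ccdf P k (i + 1) *
      (Finset.univ.filter fun t : Fin n => τ (t, i) = j).card) :
    iidMean (fun a => (P a).toReal)
      (fun s : Fin n → _ => min 1 ((2 : ℝ) ^ m / 2 ^ (streamReceived τ j s k).card)) ≤
      B ^ 2 / (δ ^ 2 * n) + 2 ^ (-(δ * n)) := by
  have hp0 : ∀ a, 0 ≤ (P a).toReal := fun a => ENNReal.toReal_nonneg
  set g : Fin n → (Fin K → Fin (B + 1)) → ℝ := fun t a =>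
    ∑ i : Fin B, if (i : ℕ) < a k ∧ τ (t, i) = j then 1 else 0 with hg
  have hcard : ∀ s : Fin n → Fin K → Fin (B + 1),
      ((streamReceived τ j s k).card : ℝ) = ∑ t, g t (s t) := by
    intro s
    simp only [hg]
    rw [← Fintype.sum_prod_type', Finset.sum_boole, streamReceived, received, Finset.filter_filter]
  have hgb : ∀ t a, 0 ≤ g t a ∧ g t a ≤ B := by
    intro t a
    refine ⟨Finset.sum_nonneg fun i _ => by split_ifs <;> norm_num, ?_⟩
    refine (Finset.sum_le_card_nsmul _ _ (1 : ℝ) fun i _ => ?_).trans_eq (by simp)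
    split_ifs <;> norm_num
  have hgm : ∑ t, ∑ a, (P a).toReal * g t a = ∑ i : Fin B, ccdf P k (i + 1) *
      (Finset.univ.filter fun t : Fin n => τ (t, i) = j).card := by
    simp only [hg, ccdf_eq_sum, Finset.mul_sum, Finset.sum_mul, Finset.card_filter, Nat.cast_sum]
    rw [Finset.sum_congr rfl fun t _ => Finset.sum_comm, Finset.sum_comm]
    refine Finset.sum_congr rfl fun i _ => Finset.sum_congr rfl fun t _ =>
      Finset.sum_congr rfl fun a _ => ?_
    by_cases h1 : (i : ℕ) < a k <;> by_cases h2 : τ (t, i) = j <;> simp [h1, h2]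
  have hpt : ∀ s : Fin n → Fin K → Fin (B + 1),
      min 1 ((2 : ℝ) ^ m / 2 ^ (streamReceived τ j s k).card) ≤
        (if ∑ t, g t (s t) < (ρ + δ) * n then 1 else 0) + 2 ^ (-(δ * n)) := by
    intro s
    have hpos : (0 : ℝ) < 2 ^ (-(δ * n)) := Real.rpow_pos_of_pos two_pos _
    split_ifs with h
    · exact (min_le_left _ _).trans (by linarith)
    · refine (min_le_right _ _).trans ?_
      rw [zero_add, ← Real.rpow_natCast 2 m, ← Real.rpow_natCast 2 (Finset.card _),
        ← Real.rpow_sub two_pos]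
      refine Real.rpow_le_rpow_of_exponent_le one_le_two ?_
      rw [hcard]
      linarith
  refine (iidMean_mono hp0 hpt).trans ?_
  rw [iidMean_add, iidMean_const (sum_pmf P)]
  gcongr
  exact iidMean_lower_tail hp0 (sum_pmf P) g hgb hδ hn (by rw [hgm]; linarith)

end Streams

/-! ### Decoding by consistency with the side information -/

section SideInformationDecoder

variable {K : ℕ} {μ : ℝ} {B N F n : ℕ}

open scoped Classical in
/-- The code with the given encoder whose decoders return the requested file of some library that is
consistent with all they know. -/
noncomputable def consistentCode (c : CachingStrategy K μ) (d : Fin K → Fin N)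
    (enc : (Fin N → Fin F → ZMod 2) → Fin n → Fin B → ZMod 2) : Code c B N F n where
  encode := enc
  decode k ℓ y z :=
    if h : ∃ W : Fin N → Fin F → ZMod 2, (fun t => channelOutput (ℓ t) (enc W t)) = y ∧
      (fun (i : Fin N) (j : c.cachedBits k F) => W i j) = z then h.choose (d k) else 0

/-- The true library is always consistent, so the decoder's default value `0` is never used on
actual outputs. -/
lemma exists_estimate_eq (c : CachingStrategy K μ) (d : Fin K → Fin N)
    (enc : (Fin N → Fin F → ZMod 2) → Fin n → Fin B → ZMod 2) (k : Fin K)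
    (W : Fin N → Fin F → ZMod 2) (s : Fin n → Fin K → Fin (B + 1)) :
    ∃ V : Fin N → Fin F → ZMod 2, (consistentCode c d enc).estimate k W s = V (d k) ∧
      (∀ q ∈ received s k, enc V q.1 q.2 = enc W q.1 q.2) ∧
      ∀ i, ∀ j ∈ c.cachedBits k F, V i j = W i j := by
  have h : ∃ V : Fin N → Fin F → ZMod 2,
      (fun t => channelOutput (s t k) (enc V t)) = (fun t => channelOutput (s t k) (enc W t)) ∧
      (fun (i : Fin N) (j : c.cachedBits k F) => V i j) =
        fun (i : Fin N) (j : c.cachedBits k F) => W i j := ⟨W, rfl, rfl⟩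
  refine ⟨h.choose, ?_, ?_, ?_⟩
  · simp only [Code.estimate, consistentCode]
    rw [dif_pos h]
  · intro q hq
    have h1 := congrFun h.choose_spec.1 q.1
    rw [channelOutput_eq_iff] at h1
    exact h1 q.2 (by simpa [received] using hq)
  · intro i j hj
    exact congrFun (congrFun h.choose_spec.2 i) ⟨j, hj⟩

/-- With everything cached, every rate is achievable. -/
lemma achievable_of_forall_cached (P : PMF (Fin K → Fin (B + 1))) (c : CachingStrategy K μ)
    (d : Fin K → Fin N) {f : ℝ} (hf : 0 ≤ f)
    (hc : ∀ k F, ∀ j : Fin F, j ∈ c.cachedBits k F) : Achievable P c d f := by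
  refine ⟨hf, fun n => consistentCode c d fun _ _ _ => 0, ?_⟩
  refine tendsto_const_nhds.congr fun n => ?_
  symm
  refine Finset.sum_eq_zero fun k _ => ?_
  refine Finset.sum_eq_zero fun W _ => Finset.sum_eq_zero fun s _ => if_neg ?_
  rw [not_ne_iff]
  obtain ⟨V, h1, -, h2⟩ := exists_estimate_eq c d (fun _ _ _ => 0) k W s
  rw [h1]
  funext j
  exact h2 _ j (hc k _ j)

end SideInformationDecoder

/-! ### Joint error of the three streams -/

section StreamCode

variable {μ : ℝ} {B N F n : ℕ}

/-- Stream `j` is meant for user `k`. -/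
def IsIntended (k : Fin 2) (j : Fin 3) : Prop := j = 2 ∨ (j : ℕ) = k

instance (k : Fin 2) (j : Fin 3) : Decidable (IsIntended k j) :=
  inferInstanceAs (Decidable (_ ∨ _))

/-- Coding the three streams independently. -/
lemma exists_stream_code (P : PMF (Fin 2 → Fin (B + 1))) (c : CachingStrategy 2 μ)
    (d : Fin 2 → Fin N) (τ : Fin n × Fin B → Fin 3) (m : Fin 3 → ℕ)
    (w : (j : Fin 3) → (Fin N → Fin F → ZMod 2) → Fin (m j) → ZMod 2)
    (hw : ∀ (k : Fin 2) (W V : Fin N → Fin F → ZMod 2),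
      (∀ i, ∀ j ∈ c.cachedBits k F, V i j = W i j) →
      (∀ j, IsIntended k j → w j V = w j W) → V (d k) = W (d k)) :
    ∃ C : Code c B N F n, ∑ k, C.errorProb P d k ≤
      ∑ j, ∑ k, if IsIntended k j then iidMean (fun a => (P a).toReal) (fun s : Fin n → _ =>
        min 1 ((2 : ℝ) ^ m j / 2 ^ (streamReceived τ j s k).card)) else 0 := by
  classical
  set p : (Fin n → Fin 2 → Fin (B + 1)) → ℝ := fun s => ∏ t, (P (s t)).toReal with hp
  have hp0 : ∀ s, 0 ≤ p s := fun s => Finset.prod_nonneg fun _ _ => ENNReal.toReal_nonneg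
  have hΩ : (Fintype.card (Fin N → Fin F → ZMod 2) : ℝ) ≠ 0 := by exact_mod_cast Fintype.card_ne_zero
  have hex : ∀ j : Fin 3, ∃ cj : (Fin (m j) → ZMod 2) → Fin n × Fin B → ZMod 2,
      ∑ k : Fin 2, ∑ W : Fin N → Fin F → ZMod 2, ∑ s : Fin n → Fin 2 → Fin (B + 1),
        (if IsIntended k j then (Fintype.card (Fin N → Fin F → ZMod 2) : ℝ)⁻¹ * p s else 0) *
        (if ∃ v, v ≠ w j W ∧ ∀ q ∈ streamReceived τ j s k, cj v q = cj (w j W) q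
          then 1 else 0) ≤
      ∑ k, if IsIntended k j then iidMean (fun a => (P a).toReal) (fun s : Fin n → _ =>
        min 1 ((2 : ℝ) ^ m j / 2 ^ (streamReceived τ j s k).card)) else 0 := by
    intro j
    -- The user is part of the transmission `x`, so one codebook is good for both receivers of the
    -- common stream at once.
    obtain ⟨cj, hcj⟩ := exists_code_collision_le
      (X := Fin 2 × (Fin N → Fin F → ZMod 2) × (Fin n → Fin 2 → Fin (B + 1)))
      (fun x => w j x.2.1) (fun x => streamReceived τ j x.2.2 x.1)
      (p := fun x => if IsIntended x.1 j then (Fintype.card (Fin N → Fin F → ZMod 2) : ℝ)⁻¹ * p x.2.2 else 0)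
      (fun x => by
        split_ifs
        · exact mul_nonneg (by positivity) (hp0 _)
        · exact le_rfl)
    refine ⟨cj, ?_⟩
    simp only [Fintype.sum_prod_type] at hcj
    refine hcj.trans_eq (Finset.sum_congr rfl fun k _ => ?_)
    have hM : (Fintype.card (Fin (m j) → ZMod 2) : ℝ) = 2 ^ m j := by simp [ZMod.card]
    rw [hM]
    split_ifs
    · rw [Finset.sum_const, Finset.card_univ, nsmul_eq_mul, iidMean, Finset.mul_sum]
      refine Finset.sum_congr rfl fun s _ => ?_
      rw [← mul_assoc, ← mul_assoc, mul_inv_cancel₀ hΩ, one_mul]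
    · simp
  choose cw hcw using hex
  refine ⟨consistentCode c d fun W t i => cw (τ (t, i)) (w (τ (t, i)) W) (t, i), ?_⟩
  refine le_trans ?_ (Finset.sum_le_sum fun j _ => hcw j)
  rw [Finset.sum_comm]
  refine Finset.sum_le_sum fun k _ => ?_
  rw [Finset.sum_comm, Code.errorProb]
  refine Finset.sum_le_sum fun W _ => ?_
  rw [Finset.sum_comm]
  refine Finset.sum_le_sum fun s _ => ?_
  have hterm : ∀ j : Fin 3, 0 ≤ (if IsIntended k j then (Fintype.card (Fin N → Fin F → ZMod 2) : ℝ)⁻¹ * p s else 0) *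
      (if ∃ v, v ≠ w j W ∧ ∀ q ∈ streamReceived τ j s k, cw j v q = cw j (w j W) q
        then 1 else 0) := by
    intro j
    refine mul_nonneg ?_ ?_ <;> split_ifs
    · exact mul_nonneg (by positivity) (hp0 _)
    all_goals norm_num
  split_ifs with herr
  · obtain ⟨V, h1, h2, h3⟩ := exists_estimate_eq c d
      (fun W t i => cw (τ (t, i)) (w (τ (t, i)) W) (t, i)) k W s
    rw [h1] at herr
    -- A wrong estimate comes from a consistent library that differs in an intended message, and
    -- that message collides with the true one on the received slots. Streams not intended for `k`
    -- never matter.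
    obtain ⟨j, hj, hne⟩ : ∃ j, IsIntended k j ∧ w j V ≠ w j W := by
      by_contra hcon
      push Not at hcon
      exact herr (hw k W V h3 hcon)
    refine le_trans ?_ (Finset.single_le_sum (fun j _ => hterm j) (Finset.mem_univ j))
    have hcoll : ∃ v, v ≠ w j W ∧ ∀ q ∈ streamReceived τ j s k, cw j v q = cw j (w j W) q := by
      refine ⟨w j V, hne, fun q hq => ?_⟩
      rw [streamReceived, Finset.mem_filter] at hq
      obtain ⟨hq, rfl⟩ := hq
      exact h2 q hq
    rw [if_pos hj, if_pos hcoll, mul_one]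
  · exact Finset.sum_nonneg fun j _ => hterm j

end StreamCode

/-! ### Network-coded messages -/

section Packing

variable {F m : ℕ}

/-- The sum of the bits of the two files in the positions `E k`, enumerated. -/
noncomputable def pack (E : Fin 2 → Finset (Fin F)) (m : ℕ) (x : Fin 2 → Fin F → ZMod 2)
    (i : Fin m) : ZMod 2 :=
  ∑ k, if h : (i : ℕ) < (E k).card then x k ((E k).equivFin.symm ⟨i, h⟩) else 0

/-- The other summand is known and cancels; padding by zeros lets position sets of different sizes
share one message. -/
lemma eq_of_pack_eq {E : Fin 2 → Finset (Fin F)} (hE : ∀ k, (E k).card ≤ m)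
    {x y : Fin 2 → Fin F → ZMod 2} (hxy : pack E m x = pack E m y) {k : Fin 2}
    (hother : ∀ k', k' ≠ k → ∀ j ∈ E k', x k' j = y k' j) {j : Fin F} (hj : j ∈ E k) :
    x k j = y k j := by
  set i := (E k).equivFin ⟨j, hj⟩ with hi
  have h := congrFun hxy ⟨i, i.isLt.trans_le (hE k)⟩
  simp only [pack] at h
  rw [← Finset.add_sum_erase _ _ (Finset.mem_univ k), ← Finset.add_sum_erase Finset.univ
    (fun k => if h : (i : ℕ) < (E k).card then y k ((E k).equivFin.symm ⟨i, h⟩) else 0)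
    (Finset.mem_univ k)] at h
  have h2 : ∑ k ∈ Finset.univ.erase k,
      (if h : (i : ℕ) < (E k).card then x k ((E k).equivFin.symm ⟨i, h⟩) else 0) =
      ∑ k ∈ Finset.univ.erase k,
      (if h : (i : ℕ) < (E k).card then y k ((E k).equivFin.symm ⟨i, h⟩) else 0) := by
    refine Finset.sum_congr rfl fun k' hk' => ?_
    split_ifs
    · exact hother k' (Finset.ne_of_mem_erase hk') _ (Subtype.coe_prop _)
    · rfl
  rw [h2, dif_pos i.isLt, dif_pos i.isLt] at h
  have h3 := add_right_cancel h
  simpa [hi] using h3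

end Packing

/-! ### Delivery from an allocation of levels -/

section Delivery

variable {μ : ℝ} {B N : ℕ}

open scoped Classical in
/-- The positions of the file of user `k` that are delivered in stream `j`: the bits cached by
nobody in the stream of `k`, the bits cached by the other user only in the common stream. -/
noncomputable def streamBits (c : CachingStrategy 2 μ) (F : ℕ) (j : Fin 3) (k : Fin 2) :
    Finset (Fin F) :=
  if j = 2 then Finset.univ.filter fun b => b ∈ c.uncached k F ∧ ∃ k', b ∉ c.uncached k' F
  else if (j : ℕ) = k then Finset.univ.filter fun b => ∀ k', b ∈ c.uncached k' F else ∅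

lemma exists_mem_streamBits (c : CachingStrategy 2 μ) {F : ℕ} {k : Fin 2} {b : Fin F}
    (hb : b ∈ c.uncached k F) : ∃ j, IsIntended k j ∧ b ∈ streamBits c F j k := by
  by_cases h : ∀ k', b ∈ c.uncached k' F
  · refine ⟨k.castSucc, Or.inr rfl, ?_⟩
    have : k.castSucc ≠ 2 := by
      fin_cases k <;> decide
    rw [streamBits, if_neg this, if_pos (show ((k.castSucc : Fin 3) : ℕ) = k from rfl)]
    simpa using h
  · push Not at h
    refine ⟨2, Or.inl rfl, ?_⟩
    rw [streamBits, if_pos rfl]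
    exact Finset.mem_filter.2 ⟨Finset.mem_univ _, hb, h⟩

/-- The cancellation property of the common stream: its foreign bits are cached by someone other
than their owner, hence by the only other user. -/
lemma mem_cachedBits_of_mem_streamBits {c : CachingStrategy 2 μ} {F : ℕ} {k k' : Fin 2}
    (hk : k' ≠ k) {j : Fin 3} (hj : IsIntended k j) {b : Fin F} (hb : b ∈ streamBits c F j k') :
    b ∈ c.cachedBits k F := by
  rw [streamBits] at hb
  split_ifs at hb with h1 h2
  · simp only [Finset.mem_filter, Finset.mem_univ, true_and] at hb
    obtain ⟨hb, k'', hk''⟩ := hb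
    have h3 : k'' ≠ k' := by
      rintro rfl
      exact hk'' hb
    have : k'' = k := by omega
    subst this
    simpa [CachingStrategy.mem_uncached] using hk''
  · rcases hj with hj | hj
    · exact absurd hj h1
    · exact absurd (Fin.ext (h2.symm.trans hj)) hk
  · simp at hb

variable (P : PMF (Fin 2 → Fin (B + 1)))

lemma ccdf_le_one (k : Fin 2) (ℓ : ℕ) : ccdf P k ℓ ≤ 1 := by
  rw [← sum_pmf P, ccdf]
  refine Finset.sum_le_sum fun a _ => ?_
  split_ifs
  · exact le_rfl
  · exact ENNReal.toReal_nonneg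

/-- The slack `4 * δ` is spent as follows: `δ` on the two extra bits per message, `2 * δ` on the
margin in `iidMean_collision_le`, and `δ` on the at most `B` slots lost to rounding. -/
lemma achievable_of_allocation (c : CachingStrategy 2 μ) (d : Fin 2 → Fin N) {f δ : ℝ} (hf : 0 ≤ f)
    (hδ : 0 < δ) {b : Fin 3 → ℝ} (hb : ∀ j, 0 ≤ b j)
    (hcard : ∀ F j k, ((streamBits c F j k).card : ℝ) ≤ b j * F + 2) {θ : Fin B → Fin 3 → ℝ}
    (hθ : IsAllocation θ)
    (hrate : ∀ j k, IsIntended k j → b j * f + 4 * δ ≤ ∑ i, θ i j * ccdf P k (i + 1)) :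
    Achievable P c d f := by
  -- The error bound is needed only for large `n`.
  have hex : ∀ n : ℕ, ∃ C : Code c B N ⌊(n : ℝ) * f⌋₊ n, B ≤ n * δ → 2 ≤ n * δ → 0 < n →
      ∑ k, C.errorProb P d k ≤ ∑ _j : Fin 3, ∑ _k : Fin 2,
        (B ^ 2 / (δ ^ 2 * n) + (2 : ℝ) ^ (-(δ * n))) := by
    intro n
    set F := ⌊(n : ℝ) * f⌋₊ with hF
    obtain ⟨τ, hτ⟩ := exists_slot_assignment (n := n) hθ
    set m : Fin 3 → ℕ := fun j => Finset.univ.sup fun k => (streamBits c F j k).card with hm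
    have hle : ∀ j k, (streamBits c F j k).card ≤ m j := fun j k =>
      Finset.le_sup (f := fun k => (streamBits c F j k).card) (Finset.mem_univ k)
    obtain ⟨C, hC⟩ := exists_stream_code P c d τ m
      (fun j W => pack (streamBits c F j) (m j) fun k => W (d k)) (by
        intro k W V hcache hstream
        funext j
        by_cases hj : j ∈ c.uncached k F
        · obtain ⟨i, hi, hmem⟩ := exists_mem_streamBits c hj
          exact eq_of_pack_eq (x := fun k => V (d k)) (y := fun k => W (d k)) (hle i) (hstream i hi)
            (fun k' hk' b hb => hcache _ b (mem_cachedBits_of_mem_streamBits hk' hi hb)) hmem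
        · rw [CachingStrategy.mem_uncached, not_not] at hj
          exact hcache _ j hj)
    refine ⟨C, fun h1 h2 h3 => hC.trans ?_⟩
    have hn : (0 : ℝ) < n := by exact_mod_cast h3
    refine Finset.sum_le_sum fun j _ => Finset.sum_le_sum fun k _ => ?_
    split_ifs with hk
    · refine iidMean_collision_le P τ j k (ρ := b j * f + δ) hδ h3 ?_ ?_
      · obtain ⟨k', -, hk'⟩ := Finset.exists_mem_eq_sup Finset.univ Finset.univ_nonempty
          fun k => (streamBits c F j k).card
        have hFle : (F : ℝ) ≤ n * f := Nat.floor_le (mul_nonneg hn.le hf)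
        have := hcard F j k'
        simp only [hm]
        rw [hk']
        nlinarith [mul_le_mul_of_nonneg_left hFle (hb j)]
      · have hsum : ∑ i : Fin B, ccdf P k (i + 1) ≤ B :=
          (Finset.sum_le_card_nsmul _ _ (1 : ℝ) fun i _ => ccdf_le_one P k _).trans_eq (by simp)
        have hterm : ∑ i : Fin B, (n * (θ i j * ccdf P k (i + 1)) - ccdf P k (i + 1)) ≤
            ∑ i : Fin B, ccdf P k (i + 1) *
              (Finset.univ.filter fun t : Fin n => τ (t, i) = j).card := by
          refine Finset.sum_le_sum fun i _ => ?_
          have := mul_le_mul_of_nonneg_left (hτ i j) (ccdf_nonneg P k (i + 1))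
          linarith
        rw [Finset.sum_sub_distrib, ← Finset.mul_sum] at hterm
        have := mul_le_mul_of_nonneg_left (hrate j k hk) hn.le
        linarith
    · have : (0 : ℝ) < 2 ^ (-(δ * n)) := Real.rpow_pos_of_pos two_pos _
      positivity
  choose C hC using hex
  refine ⟨hf, C, ?_⟩
  have hlim1 : Tendsto (fun n : ℕ => (B : ℝ) ^ 2 / (δ ^ 2 * n)) atTop (𝓝 0) := by
    have := tendsto_const_div_atTop_nhds_zero_nat ((B : ℝ) ^ 2 / δ ^ 2)
    exact this.congr fun n => div_div _ _ _
  have hlim2 : Tendsto (fun n : ℕ => (2 : ℝ) ^ (-(δ * n))) atTop (𝓝 0) := by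
    have h1 : (2 : ℝ) ^ (-δ) < 1 := Real.rpow_lt_one_of_one_lt_of_neg one_lt_two (by linarith)
    have h2 : (0 : ℝ) ≤ 2 ^ (-δ) := (Real.rpow_pos_of_pos two_pos _).le
    refine (tendsto_pow_atTop_nhds_zero_of_lt_one h2 h1).congr fun n => ?_
    rw [← Real.rpow_natCast, ← Real.rpow_mul two_pos.le, neg_mul]
  have hlim : Tendsto (fun n : ℕ => ∑ _j : Fin 3, ∑ _k : Fin 2,
      ((B : ℝ) ^ 2 / (δ ^ 2 * n) + (2 : ℝ) ^ (-(δ * n)))) atTop (𝓝 0) := by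
    have := tendsto_finsetSum (Finset.univ : Finset (Fin 3)) fun _ _ =>
      tendsto_finsetSum (Finset.univ : Finset (Fin 2)) fun _ _ => hlim1.add hlim2
    simpa using this
  have hev : ∀ x : ℝ, ∀ᶠ n : ℕ in atTop, x ≤ n * δ := fun x =>
    (tendsto_natCast_atTop_atTop.atTop_mul_const hδ).eventually_ge_atTop x
  refine squeeze_zero' (Eventually.of_forall fun n =>
    Finset.sum_nonneg fun k _ => (C n).errorProb_nonneg P d k) ?_ hlim
  filter_upwards [hev B, hev 2, eventually_gt_atTop 0] with n h1 h2 h3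
  exact hC n h1 h2 h3

/-- Of the slack `5 * δ`, one `δ` is lost in the duality argument and `4 * δ` is left for
`achievable_of_allocation`. -/
lemma achievable_of_weighted_bounds (c : CachingStrategy 2 μ) (d : Fin 2 → Fin N) {f δ : ℝ}
    (hf : 0 ≤ f) (hδ : 0 < δ) {b₀ b₁ : ℝ} (hb₀ : 0 ≤ b₀) (hb₁ : 0 ≤ b₁)
    (hcommon : ∀ F k, ((streamBits c F 2 k).card : ℝ) ≤ b₀ * F + 2)
    (hprivate : ∀ F j k, j ≠ 2 → ((streamBits c F j k).card : ℝ) ≤ b₁ * F + 2)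
    (hfst : ∀ x y : ℝ, 0 ≤ y → y ≤ x → x * ((b₀ * f + 5 * δ) + (b₁ * f + 5 * δ)) +
      y * (b₁ * f + 5 * δ) ≤ ∑ i : Fin B, max (x * ccdf P 0 (i + 1)) (y * ccdf P 1 (i + 1)))
    (hsnd : ∀ x y : ℝ, 0 ≤ x → x ≤ y → x * (b₁ * f + 5 * δ) +
      y * ((b₀ * f + 5 * δ) + (b₁ * f + 5 * δ)) ≤
        ∑ i : Fin B, max (x * ccdf P 0 (i + 1)) (y * ccdf P 1 (i + 1))) :
    Achievable P c d f := by
  have r₀ : 0 ≤ b₀ * f + 5 * δ := by positivity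
  have r₁ : 0 ≤ b₁ * f + 5 * δ := by positivity
  obtain ⟨θ, hθ, hrate⟩ := exists_allocation_of_forall_weights
    (fun i : Fin B => ccdf P 0 (i + 1)) (fun i : Fin B => ccdf P 1 (i + 1))
    ![b₁ * f + 5 * δ, b₁ * f + 5 * δ, b₀ * f + 5 * δ, b₀ * f + 5 * δ]
    (fun w hw => by
      have := weighted_rates_le (fun i : Fin B => ccdf_nonneg P 0 (i + 1))
        (fun i : Fin B => ccdf_nonneg P 1 (i + 1)) r₀ r₁ r₁ hfst hsnd (hw 0) (hw 1) (hw 2) (hw 3)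
      simp only [Fin.sum_univ_four, Matrix.cons_val]
      linarith) hδ
  have h0 := hrate 0
  have h1 := hrate 1
  have h2 := hrate 2
  have h3 := hrate 3
  simp only [allocRate, Matrix.cons_val] at h0 h1 h2 h3
  refine achievable_of_allocation P c d hf hδ (b := ![b₁, b₁, b₀]) ?_ ?_ hθ ?_
  · intro j
    fin_cases j <;> simp [hb₀, hb₁]
  · intro F j k
    fin_cases j
    · exact hprivate F 0 k (by decide)
    · exact hprivate F 1 k (by decide)
    · exact hcommon F k
  · intro j k hjk
    fin_cases j <;> fin_cases k
    · simp only [Fin.zero_eta, Matrix.cons_val]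
      linarith
    · exact absurd hjk (by decide)
    · exact absurd hjk (by decide)
    · simp only [Fin.mk_one, Matrix.cons_val]
      linarith
    · simp only [Fin.zero_eta, Fin.reduceFinMk, Matrix.cons_val]
      linarith
    · simp only [Fin.mk_one, Fin.reduceFinMk, Matrix.cons_val]
      linarith

end Delivery

/-! ### Stream lengths under the central strategy -/

section Central

variable {μ : ℝ}

lemma card_filter_interval_union_le {F a b a' b' : ℕ} {A : Finset (Fin F)}
    (hA : ∀ j ∈ A, (a ≤ (j : ℕ) ∧ (j : ℕ) < b) ∨ (a' ≤ (j : ℕ) ∧ (j : ℕ) < b')) :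
    A.card ≤ (b - a) + (b' - a') := by
  classical
  refine le_trans ?_ (Nat.add_le_add (card_filter_interval_le (F := F))
    (card_filter_interval_le (F := F)))
  refine le_trans (Finset.card_le_card fun j hj => ?_) (Finset.card_union_le _ _)
  simpa using hA j hj

lemma mem_uncached_central_of_le {h0 : 0 ≤ μ} {h1 : μ ≤ 1} (hμ : μ ≤ 1 / 2) {F : ℕ} {j : Fin F} :
    (j ∈ (centralStrategy μ h0 h1).uncached 0 F ↔
      ¬(⌈(1 - 2 * μ) * F⌉₊ ≤ (j : ℕ) ∧ (j : ℕ) < ⌊(1 - μ) * F⌋₊)) ∧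
    (j ∈ (centralStrategy μ h0 h1).uncached 1 F ↔ ¬(⌈(1 - μ) * F⌉₊ ≤ (j : ℕ))) := by
  have := j.isLt
  rw [CachingStrategy.mem_uncached, CachingStrategy.mem_uncached]
  simp only [CachingStrategy.cachedBits, centralStrategy, if_pos hμ, Matrix.cons_val,
    List.mem_singleton, exists_eq_left, Set.mem_ofPred_eq, one_mul, Nat.floor_natCast]
  constructor <;> tauto

lemma mem_uncached_central_of_lt {h0 : 0 ≤ μ} {h1 : μ ≤ 1} (hμ : 1 / 2 < μ) {F : ℕ} {j : Fin F} :
    (j ∈ (centralStrategy μ h0 h1).uncached 0 F ↔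
      ¬((j : ℕ) < ⌊(1 - μ) * F⌋₊) ∧ ¬(⌈(2 - 2 * μ) * F⌉₊ ≤ (j : ℕ))) ∧
    (j ∈ (centralStrategy μ h0 h1).uncached 1 F ↔
      ¬(⌈(1 - μ) * F⌉₊ ≤ (j : ℕ) ∧ (j : ℕ) < ⌊(2 - 2 * μ) * F⌋₊) ∧
      ¬(⌈(2 - 2 * μ) * F⌉₊ ≤ (j : ℕ))) := by
  have := j.isLt
  rw [CachingStrategy.mem_uncached, CachingStrategy.mem_uncached]
  simp only [CachingStrategy.cachedBits, centralStrategy, if_neg (not_le.2 hμ), Matrix.cons_val,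
    List.mem_cons, List.not_mem_nil, or_false, exists_eq_or_imp, exists_eq_left,
    Set.mem_ofPred_eq, one_mul, zero_mul, Nat.floor_natCast, Nat.ceil_zero, Nat.zero_le, true_and]
  constructor <;> tauto

/-- Beyond the uncached prefix, bits are missed by both users only where adjacent intervals are
rounded apart, at most one per junction. For `μ > 1/2` these are all there is. -/
lemma card_private_central_le (h0 : 0 ≤ μ) (h1 : μ ≤ 1) (F : ℕ) {j : Fin 3} (hj : j ≠ 2)
    (k : Fin 2) :
    ((streamBits (centralStrategy μ h0 h1) F j k).card : ℝ) ≤ max (1 - 2 * μ) 0 * F + 2 := by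
  have hmem : ∀ b ∈ streamBits (centralStrategy μ h0 h1) F j k,
      b ∈ (centralStrategy μ h0 h1).uncached 0 F ∧ b ∈ (centralStrategy μ h0 h1).uncached 1 F := by
    intro b hb
    rw [streamBits, if_neg hj] at hb
    split_ifs at hb
    · simp only [Finset.mem_filter, Finset.mem_univ, true_and] at hb
      exact ⟨hb 0, hb 1⟩
    · simp at hb
  have hF : (0 : ℝ) ≤ F := Nat.cast_nonneg F
  have hmax0 := le_max_right (1 - 2 * μ) 0
  have hround : ∀ x : ℝ, ⌈x⌉₊ - ⌊x⌋₊ ≤ 1 := fun x => by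
    have := Nat.ceil_le_floor_add_one x
    omega
  rcases le_or_gt μ (1 / 2) with hμ | hμ
  · have hcard := card_filter_interval_union_le
      (A := streamBits (centralStrategy μ h0 h1) F j k) (a := 0) (b := ⌈(1 - 2 * μ) * F⌉₊)
      (a' := ⌊(1 - μ) * F⌋₊) (b' := ⌈(1 - μ) * F⌉₊) fun b hb => by
        obtain ⟨hb0, hb1⟩ := hmem b hb
        rw [(mem_uncached_central_of_le hμ).1] at hb0
        rw [(mem_uncached_central_of_le hμ).2] at hb1
        omega
    have h2 := hround ((1 - μ) * F)
    have h3 : (streamBits (centralStrategy μ h0 h1) F j k).card ≤ ⌈(1 - 2 * μ) * F⌉₊ + 1 := by omega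
    have h4 : ((streamBits (centralStrategy μ h0 h1) F j k).card : ℝ) ≤
        (⌈(1 - 2 * μ) * F⌉₊ : ℝ) + 1 := by exact_mod_cast h3
    have h5 := Nat.ceil_lt_add_one (a := (1 - 2 * μ) * F) (mul_nonneg (by linarith) hF)
    rw [max_eq_left (by linarith)]
    linarith
  · have hcard := card_filter_interval_union_le
      (A := streamBits (centralStrategy μ h0 h1) F j k) (a := ⌊(1 - μ) * F⌋₊)
      (b := ⌈(1 - μ) * F⌉₊) (a' := ⌊(2 - 2 * μ) * F⌋₊) (b' := ⌈(2 - 2 * μ) * F⌉₊) fun b hb => by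
        obtain ⟨hb0, hb1⟩ := hmem b hb
        rw [(mem_uncached_central_of_lt hμ).1] at hb0
        rw [(mem_uncached_central_of_lt hμ).2] at hb1
        omega
    have h2 := hround ((1 - μ) * F)
    have h3 := hround ((2 - 2 * μ) * F)
    have h4 : (streamBits (centralStrategy μ h0 h1) F j k).card ≤ 2 := by omega
    have h5 : ((streamBits (centralStrategy μ h0 h1) F j k).card : ℝ) ≤ 2 := by exact_mod_cast h4
    nlinarith [mul_nonneg hmax0 hF]

/-- For `μ ≤ 1/2` these bits lie in the other user's cache, which has size at most `μ F`. For `μ >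
1/2` it suffices to count everything that `k` lacks. -/
lemma card_common_central_le (h0 : 0 ≤ μ) (h1 : μ ≤ 1) (F : ℕ) (k : Fin 2) :
    ((streamBits (centralStrategy μ h0 h1) F 2 k).card : ℝ) ≤ min μ (1 - μ) * F + 2 := by
  classical
  have hF : (0 : ℝ) ≤ F := Nat.cast_nonneg F
  have hmem : ∀ b ∈ streamBits (centralStrategy μ h0 h1) F 2 k,
      b ∈ (centralStrategy μ h0 h1).uncached k F ∧
      ∃ k', b ∉ (centralStrategy μ h0 h1).uncached k' F := by
    intro b hb
    rw [streamBits, if_pos rfl] at hb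
    simpa using hb
  rcases le_or_gt μ (1 / 2) with hμ | hμ
  · have hsub : streamBits (centralStrategy μ h0 h1) F 2 k ⊆
        ((centralStrategy μ h0 h1).uncached k.rev F)ᶜ := by
      intro b hb
      obtain ⟨hb0, k', hk'⟩ := hmem b hb
      have hne : k' ≠ k := by
        rintro rfl
        exact hk' hb0
      have : k' = k.rev := by
        rw [Fin.ext_iff, Fin.val_rev]
        omega
      rw [Finset.mem_compl, ← this]
      exact hk'
    have h2 : ((streamBits (centralStrategy μ h0 h1) F 2 k).card : ℝ) ≤ _ :=
      Nat.cast_le.2 (Finset.card_le_card hsub)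
    have h3 := (centralStrategy μ h0 h1).card_compl_uncached_le k.rev F
    rw [min_eq_left (by linarith)]
    linarith
  · rw [min_eq_right (by linarith)]
    have c1 := Nat.lt_floor_add_one ((1 - μ) * F)
    have c2 := Nat.ceil_lt_add_one (a := (2 - 2 * μ) * F) (mul_nonneg (by linarith) hF)
    have c3 := Nat.ceil_lt_add_one (a := (1 - μ) * F) (mul_nonneg (by linarith) hF)
    have c4 := Nat.ceil_le_floor_add_one ((2 - 2 * μ) * F)
    have c5 : ⌊(1 - μ) * F⌋₊ ≤ ⌈(2 - 2 * μ) * F⌉₊ :=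
      (Nat.floor_le_ceil _).trans (Nat.ceil_mono (by nlinarith))
    fin_cases k
    · have hcard := card_filter_interval_union_le
        (A := streamBits (centralStrategy μ h0 h1) F 2 0) (a := ⌊(1 - μ) * F⌋₊)
        (b := ⌈(2 - 2 * μ) * F⌉₊) (a' := 0) (b' := 0) fun b hb => by
          have hb0 := (hmem b hb).1
          have hb0 := (mem_uncached_central_of_lt hμ).1.1 hb0
          omega
      have h2 : (streamBits (centralStrategy μ h0 h1) F 2 0).card + ⌊(1 - μ) * F⌋₊ ≤
          ⌈(2 - 2 * μ) * F⌉₊ := by omega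
      have h3 : ((streamBits (centralStrategy μ h0 h1) F 2 0).card : ℝ) + (⌊(1 - μ) * F⌋₊ : ℝ) ≤
          (⌈(2 - 2 * μ) * F⌉₊ : ℝ) := by exact_mod_cast h2
      change ((streamBits (centralStrategy μ h0 h1) F 2 0).card : ℝ) ≤ _
      linarith
    · have hcard := card_filter_interval_union_le
        (A := streamBits (centralStrategy μ h0 h1) F 2 1) (a := 0)
        (b := ⌈(1 - μ) * F⌉₊) (a' := ⌊(2 - 2 * μ) * F⌋₊) (b' := ⌈(2 - 2 * μ) * F⌉₊) fun b hb => by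
          have hb0 := (hmem b hb).1
          have hb0 := (mem_uncached_central_of_lt hμ).2.1 hb0
          omega
      have h2 : (streamBits (centralStrategy μ h0 h1) F 2 1).card ≤ ⌈(1 - μ) * F⌉₊ + 1 := by omega
      have h3 : ((streamBits (centralStrategy μ h0 h1) F 2 1).card : ℝ) ≤
          (⌈(1 - μ) * F⌉₊ : ℝ) + 1 := by exact_mod_cast h2
      change ((streamBits (centralStrategy μ h0 h1) F 2 1).card : ℝ) ≤ _
      linarith

end Central

/-! ### Achieving the optimal rates -/

section OptimalRates

/-- A bound for all weight ratios at least one, in homogeneous form. -/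
lemma homogeneous_of_ratio {ι : Type*} [Fintype ι] {F G : ι → ℝ} (hF : ∀ i, 0 ≤ F i)
    (hG : ∀ i, 0 ≤ G i) {v p q : ℝ} (hv : 0 ≤ v) (hq : 0 ≤ q)
    (h : ∀ ω, 1 ≤ ω → v * (ω * p + q) ≤ ∑ i, max (ω * F i) (G i)) {x y : ℝ} (hy : 0 ≤ y)
    (hxy : y ≤ x) : v * (x * p + y * q) ≤ ∑ i, max (x * F i) (y * G i) := by
  have hpos : ∀ y, 0 < y → y ≤ x → v * (x * p + y * q) ≤ ∑ i, max (x * F i) (y * G i) := by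
    intro y hy hxy
    have h1 := mul_le_mul_of_nonneg_left (h (x / y) ((one_le_div hy).2 hxy)) hy.le
    rw [Finset.mul_sum] at h1
    refine le_trans (le_of_eq ?_) (h1.trans_eq (Finset.sum_congr rfl fun _ _ => ?_))
    · field_simp
    · rw [mul_max_of_nonneg _ _ hy.le]
      congr 1
      field_simp
  rcases hy.eq_or_lt with rfl | hy
  · rcases hxy.eq_or_lt with rfl | hx
    · simp
    -- For `y = 0` there is no ratio: use a small positive `y` instead, chosen so that the `G` terms
    -- add at most `ε`.
    · refine le_of_forall_pos_le_add fun ε hε => ?_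
      have hS : 0 ≤ ∑ i, G i := Finset.sum_nonneg fun i _ => hG i
      set y := min x (ε / (1 + ∑ i, G i)) with hy
      have hy0 : 0 < y := lt_min hx (by positivity)
      have h1 := hpos y hy0 (min_le_left _ _)
      have h2 : ∑ i, max (x * F i) (y * G i) ≤ ∑ i, (max (x * F i) (0 * G i) + y * G i) := by
        refine Finset.sum_le_sum fun i _ => max_le ?_ ?_
        · have := mul_nonneg hy0.le (hG i)
          linarith [le_max_left (x * F i) (0 * G i)]
        · have := mul_nonneg hx.le (hF i)
          linarith [le_max_left (x * F i) (0 * G i)]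
      rw [Finset.sum_add_distrib, ← Finset.mul_sum] at h2
      have h3 : y * ∑ i, G i ≤ ε := by
        calc y * ∑ i, G i ≤ ε / (1 + ∑ i, G i) * ∑ i, G i :=
              mul_le_mul_of_nonneg_right (min_le_right _ _) hS
          _ ≤ ε := by
              rw [div_mul_eq_mul_div, div_le_iff₀ (by positivity)]
              nlinarith
      have h4 : 0 ≤ v * (y * q) := by positivity
      linarith
  · exact hpos y hy hxy

variable {B N : ℕ} (P : PMF (Fin 2 → Fin (B + 1))) {μ : ℝ}

lemma sum_max_ccdf_nonneg (k k' : Fin 2) {ω : ℝ} (hω : 0 ≤ ω) :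
    0 ≤ ∑ i : Fin B, max (ω * ccdf P k (i + 1)) (ccdf P k' (i + 1)) :=
  Finset.sum_nonneg fun _ _ => (mul_nonneg hω (ccdf_nonneg P k _)).trans (le_max_left _ _)

lemma fStarSmall_mul_le_first (hμ : μ ≤ 1 / 2) {ω : ℝ} (hω : 1 ≤ ω) :
    fStarSmall P μ * (ω * (1 - μ) + (1 - 2 * μ)) ≤
      ∑ i : Fin B, max (ω * ccdf P 0 (i + 1)) (ccdf P 1 (i + 1)) := by
  rw [← le_div_iff₀ (by nlinarith), ← mul_R₁_add_R₂]
  -- The real infimum is a lower bound only for a family bounded below; here `0` serves.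
  refine (min_le_left _ _).trans (ciInf_le ⟨0, ?_⟩ (⟨ω, hω⟩ : Set.Ici (1 : ℝ)))
  rintro _ ⟨⟨ω', hω'⟩, rfl⟩
  have hω' : 1 ≤ ω' := hω'
  simp only
  rw [mul_R₁_add_R₂]
  exact div_nonneg (sum_max_ccdf_nonneg P 0 1 (by linarith)) (by nlinarith)

lemma fStarSmall_mul_le_second (hμ : μ ≤ 1 / 2) {ω : ℝ} (hω : 1 ≤ ω) :
    fStarSmall P μ * (ω * (1 - μ) + (1 - 2 * μ)) ≤
      ∑ i : Fin B, max (ω * ccdf P 1 (i + 1)) (ccdf P 0 (i + 1)) := by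
  have hω0 : 0 < ω := by linarith
  have hinv : 1 / (1 / ω) = ω := one_div_one_div ω
  have h := R₁_add_mul_R₂ P (one_div_pos.2 hω0)
  rw [hinv] at h
  rw [← le_div_iff₀ (by nlinarith), ← h, add_comm (ω * (1 - μ))]
  refine (min_le_right _ _).trans ((ciInf_le ⟨0, ?_⟩ (⟨1 / ω, one_div_pos.2 hω0,
    (div_le_one hω0).2 hω⟩ : Set.Ioc (0 : ℝ) 1)).trans_eq ?_)
  · rintro _ ⟨⟨ω', hω', hω''⟩, rfl⟩
    simp only
    rw [R₁_add_mul_R₂ P hω']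
    have : 0 < 1 / ω' := one_div_pos.2 hω'
    exact div_nonneg (sum_max_ccdf_nonneg P 1 0 this.le) (by nlinarith)
  · simp only [hinv]

lemma achievable_central_small (h0 : 0 ≤ μ) (h1 : μ ≤ 1) (hμ : μ ≤ 1 / 2) (d : Fin 2 → Fin N)
    {f : ℝ} (hf : 0 ≤ f) (hlt : f < fStarSmall P μ) :
    Achievable P (centralStrategy μ h0 h1) d f := by
  set v := fStarSmall P μ with hv
  have hv0 : 0 ≤ v := hf.trans hlt.le
  have hF : ∀ k, ∀ i : Fin B, 0 ≤ ccdf P k (i + 1) := fun k i => ccdf_nonneg P k _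
  have hmax : max (1 - 2 * μ) 0 = 1 - 2 * μ := max_eq_left (by linarith)
  have hmin : min μ (1 - μ) = μ := min_eq_left (by linarith)
  -- The total slack `10 δ x + 5 δ y` is at most `15 δ x = (v - f) x / 2`, which the gain `(v - f) x
  -- (1 - μ)` covers since `μ ≤ 1/2`. This fixes the constant `30`.
  have hslack : ∀ x y : ℝ, 0 ≤ y → y ≤ x →
      x * (μ * f + 5 * ((v - f) / 30) + ((1 - 2 * μ) * f + 5 * ((v - f) / 30))) +
        y * ((1 - 2 * μ) * f + 5 * ((v - f) / 30)) ≤ v * (x * (1 - μ) + y * (1 - 2 * μ)) := by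
    intro x y hy hxy
    have hx : 0 ≤ x := hy.trans hxy
    have hg : 0 ≤ v - f := by linarith
    have e1 : 0 ≤ (v - f) * (x * (1 / 2 - μ)) := mul_nonneg hg (mul_nonneg hx (by linarith))
    have e2 : 0 ≤ (v - f) * (y * (1 - 2 * μ)) := mul_nonneg hg (mul_nonneg hy (by linarith))
    have e3 : 0 ≤ (v - f) * (x - y) := mul_nonneg hg (by linarith)
    nlinarith
  refine achievable_of_weighted_bounds P _ d hf (δ := (v - f) / 30) (by linarith) h0
    (by linarith : 0 ≤ 1 - 2 * μ)
    (fun F k => by simpa only [hmin] using card_common_central_le h0 h1 F k)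
    (fun F j k hj => by simpa only [hmax] using card_private_central_le h0 h1 F hj k) ?_ ?_
  · intro x y hy hxy
    exact (hslack x y hy hxy).trans (homogeneous_of_ratio (hF 0) (hF 1) hv0 (by linarith)
      (fun ω hω => fStarSmall_mul_le_first P hμ hω) hy hxy)
  · intro x y hx hxy
    rw [add_comm, Finset.sum_congr rfl fun i _ => max_comm _ _]
    exact (hslack y x hx hxy).trans (homogeneous_of_ratio (hF 1) (hF 0) hv0 (by linarith)
      (fun ω hω => fStarSmall_mul_le_second P hμ hω) hx hxy)

/-- Apart from rounding, everything travels in the common stream, so each user's single-user bound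
is enough. -/
lemma achievable_central_large (h0 : 0 ≤ μ) (h1 : μ ≤ 1) (hμ : 1 / 2 ≤ μ) (hμ1 : μ < 1)
    (d : Fin 2 → Fin N) {f : ℝ} (hf : 0 ≤ f) (hlt : f < fStarLarge P μ) :
    Achievable P (centralStrategy μ h0 h1) d f := by
  set v := fStarLarge P μ with hv
  have hmax : max (1 - 2 * μ) 0 = 0 := max_eq_right (by linarith)
  have hmin : min μ (1 - μ) = 1 - μ := min_eq_right (by linarith)
  have hle : ∀ k : Fin 2, v * (1 - μ) ≤ ∑ i : Fin B, ccdf P k (i + 1) := by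
    intro k
    rw [← le_div_iff₀ (by linarith), ← sum_Icc_levels B fun ℓ => ccdf P k ℓ]
    fin_cases k
    · exact min_le_left _ _
    · exact min_le_right _ _
  set δ := (v - f) * (1 - μ) / 15 with hδ
  have hδ0 : 0 < δ := by
    have := mul_pos (sub_pos.2 hlt) (sub_pos.2 hμ1)
    positivity
  -- As `y ≤ x`, the slack is at most `15 δ x`, which by the choice of `δ` is exactly the gap `(v -
  -- f) (1 - μ) x`.
  have hslack : ∀ x y : ℝ, 0 ≤ y → y ≤ x →
      x * ((1 - μ) * f + 5 * δ + (0 * f + 5 * δ)) + y * (0 * f + 5 * δ) ≤ x * (v * (1 - μ)) := by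
    intro x y hy hxy
    have e1 : x * (15 * δ) = x * ((v - f) * (1 - μ)) := by
      rw [hδ]
      ring
    nlinarith [mul_le_mul_of_nonneg_right hxy hδ0.le]
  refine achievable_of_weighted_bounds P _ d hf hδ0 (by linarith : 0 ≤ 1 - μ) le_rfl
    (fun F k => by simpa only [hmin] using card_common_central_le h0 h1 F k)
    (fun F j k hj => by simpa only [hmax] using card_private_central_le h0 h1 F hj k) ?_ ?_
  · intro x y hy hxy
    refine (hslack x y hy hxy).trans ((mul_le_mul_of_nonneg_left (hle 0) (hy.trans hxy)).trans ?_)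
    rw [Finset.mul_sum]
    exact Finset.sum_le_sum fun i _ => le_max_left _ _
  · intro x y hx hxy
    rw [add_comm]
    refine (hslack y x hx hxy).trans ((mul_le_mul_of_nonneg_left (hle 1) (hx.trans hxy)).trans ?_)
    rw [Finset.mul_sum]
    exact Finset.sum_le_sum fun i _ => le_max_right _ _

lemma achievable_central_one (h0 : 0 ≤ μ) (h1 : μ ≤ 1) (hμ : μ = 1) (d : Fin 2 → Fin N)
    {f : ℝ} (hf : 0 ≤ f) : Achievable P (centralStrategy μ h0 h1) d f := by
  refine achievable_of_forall_cached P _ d hf fun k F j => ?_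
  subst hμ
  by_contra hcon
  rw [← CachingStrategy.mem_uncached] at hcon
  have h2 : (1 : ℝ) / 2 < 1 := by norm_num
  fin_cases k
  · have := ((mem_uncached_central_of_lt h2).1.1 hcon).2
    norm_num at this
  · have := ((mem_uncached_central_of_lt h2).2.1 hcon).2
    norm_num at this

end OptimalRates

end DTVBC

theorem theorem1 (B N : ℕ) (P : PMF (Fin 2 → Fin (B + 1))) (μ : ℝ) (h0 : 0 ≤ μ) (h1 : μ ≤ 1)
    (d : Fin 2 → Fin N) (hd : Function.Injective d) :
    (μ ≤ 1 / 2 →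
      (∀ (c : DTVBC.CachingStrategy 2 μ) (f : ℝ),
        DTVBC.Achievable P c d f → f ≤ DTVBC.fStarSmall P μ) ∧
      (∀ f : ℝ, 0 ≤ f → f < DTVBC.fStarSmall P μ →
        DTVBC.Achievable P (DTVBC.centralStrategy μ h0 h1) d f)) ∧
    (1 / 2 ≤ μ → μ < 1 →
      (∀ (c : DTVBC.CachingStrategy 2 μ) (f : ℝ),
        DTVBC.Achievable P c d f → f ≤ DTVBC.fStarLarge P μ) ∧
      (∀ f : ℝ, 0 ≤ f → f < DTVBC.fStarLarge P μ →
        DTVBC.Achievable P (DTVBC.centralStrategy μ h0 h1) d f)) ∧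
    (μ = 1 → ∀ f : ℝ, 0 ≤ f →
      DTVBC.Achievable P (DTVBC.centralStrategy μ h0 h1) d f) :=
  ⟨fun hμ => ⟨fun _ _ h => h.le_fStarSmall hμ hd,
      fun _ hf hlt => DTVBC.achievable_central_small P h0 h1 hμ d hf hlt⟩,
    fun hμ hμ1 => ⟨fun _ _ h => h.le_fStarLarge hμ1,
      fun _ hf hlt => DTVBC.achievable_central_large P h0 h1 hμ hμ1 d hf hlt⟩,
    fun hμ _ hf => DTVBC.achievable_central_one P h0 h1 hμ d hf⟩
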